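/- Let $\mathscr M_+([0,\infty))$ be the set of finite positive Borel measures on $[0,\infty)$, with the narrow topology (convergence against bounded continuous functions), let $M_\alpha(\mu)=\int_{[0,\infty)}x^\alpha\,d\mu(x)$, and let $\mathscr M_+^1([0,\infty))=\{\mu\in\mathscr M_+([0,\infty)):M_1(\mu)<\infty\}$. Let $C^1_b([0,\infty))$ be the set of continuously differentiable functions on $[0,\infty)$ that are bounded together with their derivative. For $\varphi\in C^1_b([0,\infty))$ and $\mu\in\mathscr M^1_+([0,\infty))$ put $$\Lambda(\varphi)(x,y)=\varphi(x+y)+\varphi(|x-y|)-2\varphi(\max\{x,y\}),\qquad \mathcal L(\varphi)(x)=x\varphi(x)-2\int_0^x\varphi(y)\,dy,$$ $$\widetilde{\mathscr Q}_3(\varphi,\mu)=\iint_{(0,\infty)^2}\frac{\Lambda(\varphi)(x,y)}{\sqrt{xy}}\,d\mu(x)\,d\mu(y)-\int_{(0,\infty)}\frac{\mathcal L(\varphi)(x)}{\sqrt x}\,d\mu(x).$$ **Theorem.** Let $h\in C([0,\infty);\mathscr M_+^1([0,\infty)))$ (continuous for the narrow topology) be a weak solution of $$\frac{d}{d\tau}\int_{[0,\infty)}\varphi(x)\,dh(\tau)(x)=\widetilde{\mathscr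 Q}_3(\varphi,h(\tau))\qquad\forall\varphi\in C^1_b([0,\infty)),$$ meaning that for every $\varphi\in C_b^1([0,\infty))$ the function $\tau\mapsto\int_{[0,\infty)}\varphi\,dh(\tau)$ is locally absolutely continuous on $[0,\infty)$ (for instance locally Lipschitz) and the equation holds for a.e. $\tau>0$. Suppose that $h(0)=h_0\in\mathscr M_+^1([0,\infty))$ with $N=M_0(h_0)>0$ and $E=M_1(h_0)>0$. Then the function $m(\tau)=h(\tau)(\{0\})$ is right continuous, a.e. differentiable and strictly increasing on $[0,\infty)$. -/

import Mathlib

open MeasureTheory Set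
open scoped NNReal ENNReal

namespace BoseCondensate

noncomputable section

/-- The moment `M_α(μ) = ∫_{[0,∞)} x^α dμ(x)`, with values in `[0,∞]`. -/
def moment (α : ℝ) (μ : FiniteMeasure ℝ≥0) : ℝ≥0∞ :=
  ∫⁻ x : ℝ≥0, (x : ℝ≥0∞) ^ α ∂(μ : Measure ℝ≥0)

/-- `φ ∈ C¹_b([0,∞))`: `φ` is continuously differentiable on `[0,∞)` (one-sidedly at `0`),
and `φ` and `φ'` are bounded there. The values of `φ` on `(-∞,0)` play no role. -/
def IsC1b (φ : ℝ → ℝ) : Prop :=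
  ContDiffOn ℝ 1 φ (Ici 0) ∧
    (∃ C : ℝ, ∀ x ∈ Ici (0 : ℝ), |φ x| ≤ C) ∧
    (∃ C : ℝ, ∀ x ∈ Ici (0 : ℝ), |derivWithin φ (Ici 0) x| ≤ C)

/-- `Λ(φ)(x,y) = φ(x+y) + φ(|x-y|) - 2 φ(max{x,y})`. -/
def Lam (φ : ℝ → ℝ) (x y : ℝ) : ℝ :=
  φ (x + y) + φ |x - y| - 2 * φ (max x y)

/-- `L(φ)(x) = x φ(x) - 2 ∫₀ˣ φ(y) dy`. -/
def calL (φ : ℝ → ℝ) (x : ℝ) : ℝ :=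
  x * φ x - 2 * ∫ y in (0 : ℝ)..x, φ y

/-- The quadratic term `∬_{(0,∞)²} Λ(φ)(x,y) / √(xy) dμ(x) dμ(y)`. -/
def Q32 (φ : ℝ → ℝ) (μ : FiniteMeasure ℝ≥0) : ℝ :=
  ∫ p in (Ioi (0 : ℝ≥0)) ×ˢ (Ioi (0 : ℝ≥0)),
    Lam φ (p.1 : ℝ) (p.2 : ℝ) / Real.sqrt ((p.1 : ℝ) * (p.2 : ℝ))
      ∂((μ : Measure ℝ≥0).prod (μ : Measure ℝ≥0))

/-- The linear term `∫_{(0,∞)} L(φ)(x) / √x dμ(x)`. -/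
def Q31tilde (φ : ℝ → ℝ) (μ : FiniteMeasure ℝ≥0) : ℝ :=
  ∫ x in Ioi (0 : ℝ≥0), calL φ (x : ℝ) / Real.sqrt (x : ℝ) ∂(μ : Measure ℝ≥0)

/-- The full operator: quadratic term minus linear term. -/
def Q3tilde (φ : ℝ → ℝ) (μ : FiniteMeasure ℝ≥0) : ℝ :=
  Q32 φ μ - Q31tilde φ μ

/-- `h`, restricted to times `τ ≥ 0`, is a weak solution of
`d/dτ ∫ φ dh(τ) = Q3tilde φ (h τ)` for all `φ ∈ C¹_b([0,∞))`: the function `τ ↦ ∫ φ dh(τ)` is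
locally absolutely continuous on `[0,∞)` (in particular this allows all functions of class
`W^{1,∞}_loc([0,∞))`, i.e. locally Lipschitz ones) and the equation holds for a.e. `τ > 0`, with
an exceptional set that may depend on `φ`. -/
def IsWeakSolution (h : ℝ → FiniteMeasure ℝ≥0) : Prop :=
  ∀ φ : ℝ → ℝ, IsC1b φ →
    (∀ T : ℝ, 0 < T → AbsolutelyContinuousOnInterval
      (fun τ => ∫ x : ℝ≥0, φ (x : ℝ) ∂(h τ : Measure ℝ≥0)) 0 T) ∧
    ∀ᵐ τ ∂(volume.restrict (Ioi (0 : ℝ))),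
      HasDerivAt (fun s => ∫ x : ℝ≥0, φ (x : ℝ) ∂(h s : Measure ℝ≥0)) (Q3tilde φ (h τ)) τ

/-- `h ∈ C([0,∞); M₊¹([0,∞)))`: finite first moment at each time `τ ≥ 0`, and continuity on
`[0,∞)` for the narrow topology (the topology of `FiniteMeasure`). -/
def IsNarrowCurve (h : ℝ → FiniteMeasure ℝ≥0) : Prop :=
  ContinuousOn h (Ici 0) ∧ ∀ τ ∈ Ici (0 : ℝ), moment 1 (h τ) < ∞

/-- The mass `m(τ) = h(τ,{0})` of the atom at the origin. -/
def atomAtZero (h : ℝ → FiniteMeasure ℝ≥0) (τ : ℝ) : ℝ :=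
  (h τ : Measure ℝ≥0).real {0}

end

end BoseCondensate

/-
The convex bumps `(1 - c x)₊²` have nonnegative second difference `Λ` and nonpositive `L`, so their
integrals against `h(τ)` are nondecreasing in time; the atom at `0` is their infimum over `c`, hence
nondecreasing as well.

Suppose the atom were constant on an interval. Since `∫ x e⁻ˣ dh(τ)` stays positive (Gronwall), the
linear term makes the excess `fₙ` of the integral of the bump of width `2⁻ⁿ` over the atom grow at
rate at least of order `2⁻ⁿ`. The quadratic term adds `2⁻ⁿ ∑_{k ≤ n} (2ᵏ Jₖ)²` up to a constant,
where `Jₖ` is the mass of the dyadic shell `(2⁻ᵏ⁻¹, 2⁻ᵏ]`; its diagonal part gives a Riccati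
inequality. Together they keep the densities `2ⁿ fₙ` between two positive constants, so each of the
`N + 1` scales above `2⁻ᴺ` contributes on average equally to the growth of `2ᴺ f_N`, which is
therefore unbounded, a contradiction.
-/

namespace BoseCondensate

open Filter Topology

theorem le_sub_of_absolutelyContinuous {f : ℝ → ℝ} {s t c : ℝ} (hst : s ≤ t)
    (hf : AbsolutelyContinuousOnInterval f s t)
    (hderiv : ∀ᵐ u, u ∈ Ioo s t → ∃ d, HasDerivAt f d u ∧ c ≤ d) :
    c * (t - s) ≤ f t - f s := by
  have hle : ∀ᵐ u ∂volume.restrict (Icc s t), c ≤ deriv f u := by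
    rw [← restrict_Ioo_eq_restrict_Icc, ae_restrict_iff' measurableSet_Ioo]
    filter_upwards [hderiv] with u hu hmem
    obtain ⟨d, hd, hcd⟩ := hu hmem
    rwa [hd.deriv]
  calc c * (t - s) = ∫ _ in s..t, c := by simp [mul_comm]
    _ ≤ ∫ u in s..t, deriv f u := intervalIntegral.integral_mono_ae_restrict hst
        intervalIntegrable_const hf.intervalIntegrable_deriv hle
    _ = f t - f s := hf.integral_deriv_eq_sub

theorem monotoneOn_of_absolutelyContinuous {f : ℝ → ℝ} {a b : ℝ}
    (hf : AbsolutelyContinuousOnInterval f a b)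
    (hderiv : ∀ᵐ u, u ∈ Ioo a b → ∃ d, HasDerivAt f d u ∧ 0 ≤ d) :
    MonotoneOn f (Icc a b) := by
  intro s hs t ht hst
  have hsub : uIcc s t ⊆ uIcc a b := by
    rw [uIcc_of_le hst, uIcc_of_le (hs.1.trans hs.2)]
    exact Icc_subset_Icc hs.1 ht.2
  have := le_sub_of_absolutelyContinuous hst (hf.mono hsub) (c := 0) <| by
    filter_upwards [hderiv] with u hu hmem
    exact hu ⟨hs.1.trans_lt hmem.1, hmem.2.trans_le ht.2⟩
  linarith

theorem absolutelyContinuousOnInterval_sum {ι : Type*} (S : Finset ι) {f : ι → ℝ → ℝ} {s t : ℝ}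
    (hf : ∀ i ∈ S, AbsolutelyContinuousOnInterval (f i) s t) :
    AbsolutelyContinuousOnInterval (fun u => ∑ i ∈ S, f i u) s t := by
  classical
  induction S using Finset.induction_on with
  | empty =>
    simpa only [Finset.sum_empty] using
      (LipschitzWith.const (0 : ℝ)).lipschitzOnWith.absolutelyContinuousOnInterval
  | insert i S hi ih =>
    simp only [Finset.sum_insert hi]
    exact (hf i (Finset.mem_insert_self i S)).add
      (ih fun j hj => hf j (Finset.mem_insert_of_mem hj))

theorem absolutelyContinuousOnInterval_lipschitzOnWith_comp {X Y : Type*} [PseudoMetricSpace X]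
    [PseudoMetricSpace Y] {f : ℝ → X} {g : X → Y} {s t : ℝ} {S : Set X} {K : ℝ≥0}
    (hg : LipschitzOnWith K g S) (hf : AbsolutelyContinuousOnInterval f s t)
    (hfS : MapsTo f (uIcc s t) S) : AbsolutelyContinuousOnInterval (g ∘ f) s t := by
  refine squeeze_zero' (Eventually.of_forall fun _ => Finset.sum_nonneg fun _ _ => dist_nonneg) ?_
    (by simpa only [mul_zero] using Tendsto.const_mul (K : ℝ) hf)
  refine Eventually.filter_mono inf_le_right (eventually_principal.2 fun E hE => ?_)
  rw [Finset.mul_sum]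
  exact Finset.sum_le_sum fun i hi =>
    hg.dist_le_mul _ (hfS (hE.1 i hi).1) _ (hfS (hE.1 i hi).2)

theorem lipschitzOnWith_inv_Ici {r : ℝ≥0} (hr : 0 < r) :
    LipschitzOnWith (r ^ 2)⁻¹ (fun y : ℝ => y⁻¹) (Ici (r : ℝ)) := by
  refine LipschitzOnWith.of_dist_le_mul fun x hx y hy => ?_
  have hr' : (0 : ℝ) < r := hr
  have hx0 : 0 < x := hr'.trans_le hx
  have hy0 : 0 < y := hr'.trans_le hy
  have hxy : (r : ℝ) ^ 2 ≤ x * y := by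
    rw [sq]
    exact mul_le_mul hx hy hr'.le hx0.le
  calc dist x⁻¹ y⁻¹ = (x * y)⁻¹ * dist x y := by
        rw [Real.dist_eq, Real.dist_eq, inv_sub_inv hx0.ne' hy0.ne', abs_div, abs_sub_comm,
          abs_of_pos (mul_pos hx0 hy0), div_eq_inv_mul]
    _ ≤ ((r : ℝ) ^ 2)⁻¹ * dist x y := by gcongr
    _ = _ := by push_cast; rfl

theorem riccati_bound {Y : ℝ → ℝ} {s b κ : ℝ} (hsb : s ≤ b) (hκ : 0 ≤ κ)
    (hY : AbsolutelyContinuousOnInterval Y s b) (hpos : 0 < Y s)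
    (hderiv : ∀ᵐ u, u ∈ Ioo s b → ∃ d, HasDerivAt Y d u ∧ κ * Y u ^ 2 ≤ d) :
    κ * (b - s) * Y s ≤ 1 := by
  have hmono : MonotoneOn Y (Icc s b) := monotoneOn_of_absolutelyContinuous hY <| by
    filter_upwards [hderiv] with u hu hmem
    obtain ⟨d, hd, hκd⟩ := hu hmem
    exact ⟨d, hd, le_trans (by positivity) hκd⟩
  have hge : ∀ u ∈ Icc s b, Y s ≤ Y u := fun u hu => hmono (left_mem_Icc.2 hsb) hu hu.1
  have hinv : AbsolutelyContinuousOnInterval (fun u => -(Y u)⁻¹) s b :=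
    (absolutelyContinuousOnInterval_lipschitzOnWith_comp
      (lipschitzOnWith_inv_Ici (r := ⟨Y s, hpos.le⟩) hpos) hY (by rwa [uIcc_of_le hsb])).neg
  have hgrowth : κ * (b - s) ≤ -(Y b)⁻¹ - -(Y s)⁻¹ :=
    le_sub_of_absolutelyContinuous hsb hinv <| by
      filter_upwards [hderiv] with u hu hmem
      obtain ⟨d, hd, hκd⟩ := hu hmem
      have hYu : 0 < Y u := hpos.trans_le (hge u (Ioo_subset_Icc_self hmem))
      refine ⟨_, (hd.fun_inv hYu.ne').neg, ?_⟩
      rwa [neg_div, neg_neg, le_div_iff₀ (by positivity)]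
  have hYb : 0 < Y b := hpos.trans_le (hge b (right_mem_Icc.2 hsb))
  calc κ * (b - s) * Y s ≤ (Y s)⁻¹ * Y s := by
        gcongr
        linarith [inv_pos.2 hYb]
    _ = 1 := inv_mul_cancel₀ hpos.ne'

theorem exp_mul_le_of_absolutelyContinuous {f : ℝ → ℝ} {s t K : ℝ} (hst : s ≤ t)
    (hf : AbsolutelyContinuousOnInterval f s t)
    (hderiv : ∀ᵐ u, u ∈ Ioo s t → ∃ d, HasDerivAt f d u ∧ -K * f u ≤ d) :
    Real.exp (-K * (t - s)) * f s ≤ f t := by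
  have hexp : ∀ u, HasDerivAt (fun u => Real.exp (K * u)) (Real.exp (K * u) * K) u := fun u => by
    simpa using ((hasDerivAt_id u).const_mul K).exp
  have hg : AbsolutelyContinuousOnInterval (fun u => Real.exp (K * u) * f u) s t :=
    (ContDiff.contDiffOn (by fun_prop)).absolutelyContinuousOnInterval.mul hf
  have hmono : Real.exp (K * s) * f s ≤ Real.exp (K * t) * f t :=
    monotoneOn_of_absolutelyContinuous hg (by
      filter_upwards [hderiv] with u hu hmem
      obtain ⟨d, hd, hKd⟩ := hu hmem
      refine ⟨_, (hexp u).mul hd, ?_⟩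
      have : 0 ≤ Real.exp (K * u) * (d + K * f u) := mul_nonneg (Real.exp_pos _).le (by linarith)
      linarith) (left_mem_Icc.2 hst) (right_mem_Icc.2 hst) hst
  calc Real.exp (-K * (t - s)) * f s
      = Real.exp (-K * t) * (Real.exp (K * s) * f s) := by
        rw [← mul_assoc, ← Real.exp_add]; ring_nf
    _ ≤ Real.exp (-K * t) * (Real.exp (K * t) * f t) := by gcongr
    _ = f t := by rw [← mul_assoc, ← Real.exp_add]; simp

theorem sq_sum_Ico_le_geometric {q : ℝ} (h0 : 0 < q) (h1 : q < 1) (n N : ℕ) (x : ℕ → ℝ) :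
    (∑ k ∈ Finset.Ico n N, x k) ^ 2 ≤ q ^ n / (1 - q) * ∑ k ∈ Finset.Ico n N, x k ^ 2 / q ^ k := by
  calc (∑ k ∈ Finset.Ico n N, x k) ^ 2
      ≤ (∑ k ∈ Finset.Ico n N, q ^ k) * ∑ k ∈ Finset.Ico n N, x k ^ 2 / q ^ k :=
        Finset.sum_sq_le_sum_mul_sum_of_sq_le_mul _ (fun _ _ => by positivity)
          (fun _ _ => by positivity) fun k _ => by field_simp; rfl
    _ ≤ _ := by gcongr; exact geom_sum_Ico_le_of_lt_one h0.le h1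

theorem sum_two_pow_mul_le {f J : ℕ → ℝ} {r : ℝ} {L : ℕ} (hr : 0 ≤ r) (hJ : ∀ k, 0 ≤ J k)
    (hf : ∀ n < L, f n ≤ ∑ k ∈ Finset.Ico n L, J k + r) :
    ∑ n ∈ Finset.range L, 2 ^ n * f n ≤ 2 * ∑ k ∈ Finset.range L, 2 ^ k * J k + 2 ^ L * r := by
  have hgeom : ∀ m : ℕ, ∑ n ∈ Finset.range m, (2 : ℝ) ^ n ≤ 2 ^ m := fun m => by
    rw [geom_sum_eq (by norm_num)]; norm_num
  have hswap : ∑ n ∈ Finset.range L, ∑ k ∈ Finset.Ico n L, 2 ^ n * J k =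
      ∑ k ∈ Finset.range L, ∑ n ∈ Finset.range (k + 1), 2 ^ n * J k :=
    Finset.sum_comm' fun n k => by simp only [Finset.mem_range, Finset.mem_Ico]; omega
  calc ∑ n ∈ Finset.range L, 2 ^ n * f n
      ≤ ∑ n ∈ Finset.range L, 2 ^ n * (∑ k ∈ Finset.Ico n L, J k + r) := by
        gcongr with n hn
        exact hf n (Finset.mem_range.1 hn)
    _ = ∑ k ∈ Finset.range L, (∑ n ∈ Finset.range (k + 1), 2 ^ n) * J k
          + (∑ n ∈ Finset.range L, 2 ^ n) * r := by
        simp only [mul_add, Finset.sum_add_distrib, Finset.mul_sum, hswap, Finset.sum_mul]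
    _ ≤ ∑ k ∈ Finset.range L, 2 ^ (k + 1) * J k + 2 ^ L * r := by
        gcongr with k
        · exact hJ k
        · exact hgeom (k + 1)
        · exact hgeom L
    _ = _ := by
        rw [Finset.mul_sum]
        simp only [pow_succ', mul_assoc]

/-- The differential inequalities satisfied by the masses `f n` of a solution near the origin,
at the dyadic scale `2⁻ⁿ`, when the mass of the origin itself is constant on `[a, b]`;
`J k` is the mass of `(2⁻ᵏ⁻¹, 2⁻ᵏ]` and `D n` the time derivative of `f n`. -/
structure DyadicCascade (a b : ℝ) (f J D : ℕ → ℝ → ℝ) : Prop where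
  nonneg : ∀ n, ∀ t ∈ Icc a b, 0 ≤ f n t
  mass_nonneg : ∀ k t, 0 ≤ J k t
  antitone : ∀ t ∈ Icc a b, Antitone fun n => f n t
  tendsto_zero : Tendsto (fun n => f n b) atTop (𝓝 0)
  le_sum : ∀ t ∈ Icc a b, ∀ n N, n ≤ N → f n t ≤ ∑ k ∈ Finset.Ico n (N + 1), J k t + 4 * f N t
  absolutelyContinuous : ∀ n, AbsolutelyContinuousOnInterval (f n) a b
  hasDerivAt : ∀ n, ∀ᵐ u, u ∈ Ioo a b → HasDerivAt (f n) (D n u) u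
  flux_le : ∀ n, ∀ u ∈ Ioo a b,
    (1 / 4) * (1 / 2) ^ n * ∑ k ∈ Finset.range (n + 1), (2 ^ k * J k u) ^ 2 ≤ D n u

namespace DyadicCascade

variable {a b : ℝ} {f J D : ℕ → ℝ → ℝ}

theorem monotoneOn (H : DyadicCascade a b f J D) (n : ℕ) : MonotoneOn (f n) (Icc a b) :=
  monotoneOn_of_absolutelyContinuous (H.absolutelyContinuous n) <| by
    filter_upwards [H.hasDerivAt n] with u hu hmem
    exact ⟨_, hu hmem, le_trans (by positivity) (H.flux_le n u hmem)⟩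

theorem le_sub (H : DyadicCascade a b f J D) (n : ℕ) {c s t : ℝ} (hs : a ≤ s) (hst : s ≤ t)
    (ht : t ≤ b) (hc : ∀ u ∈ Ioo s t, c ≤ D n u) : c * (t - s) ≤ f n t - f n s := by
  have hsub : uIcc s t ⊆ uIcc a b := by
    rw [uIcc_of_le hst, uIcc_of_le (hs.trans (hst.trans ht))]
    exact Icc_subset_Icc hs ht
  refine le_sub_of_absolutelyContinuous hst ((H.absolutelyContinuous n).mono hsub) ?_
  filter_upwards [H.hasDerivAt n] with u hu hmem
  exact ⟨_, hu ⟨hs.trans_lt hmem.1, hmem.2.trans_le ht⟩, hc u hmem⟩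

theorem diagonal_flux_le (H : DyadicCascade a b f J D) (n : ℕ) {u : ℝ} (hu : u ∈ Ioo a b) :
    (1 / 4) * 2 ^ n * J n u ^ 2 ≤ D n u :=
  calc (1 / 4) * 2 ^ n * J n u ^ 2 = (1 / 4) * (1 / 2) ^ n * (2 ^ n * J n u) ^ 2 := by
        rw [one_div_pow]; field_simp
    _ ≤ (1 / 4) * (1 / 2) ^ n * ∑ k ∈ Finset.range (n + 1), (2 ^ k * J k u) ^ 2 := by
        gcongr
        exact Finset.single_le_sum (f := fun k => (2 ^ k * J k u) ^ 2) (fun _ _ => sq_nonneg _)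
          (Finset.self_mem_range_succ n)
    _ ≤ D n u := H.flux_le n u hu

/-- The Lyapunov function of the cascade: an average of the masses at the scales `n, …, N` whose
geometric weights make the diagonal part of the flux control its square. -/
noncomputable def potential (f : ℕ → ℝ → ℝ) (n N : ℕ) (t : ℝ) : ℝ :=
  (∑ k ∈ Finset.Ico n (N + 1), (2 / 3) ^ k * f k t) / (3 * (2 / 3) ^ n)

theorem potential_le (H : DyadicCascade a b f J D) (n N : ℕ) {t : ℝ} (ht : t ∈ Icc a b) :
    potential f n N t ≤ f n t := by
  refine div_le_of_le_mul₀ (by positivity) (H.nonneg n t ht) ?_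
  calc ∑ k ∈ Finset.Ico n (N + 1), (2 / 3) ^ k * f k t
      ≤ ∑ k ∈ Finset.Ico n (N + 1), (2 / 3) ^ k * f n t := by
        gcongr with k hk
        exact H.antitone t ht (Finset.mem_Ico.1 hk).1
    _ = (∑ k ∈ Finset.Ico n (N + 1), (2 / 3) ^ k) * f n t := by rw [Finset.sum_mul]
    _ ≤ (2 / 3) ^ n / (1 - 2 / 3) * f n t := by
        gcongr
        · exact H.nonneg n t ht
        · exact geom_sum_Ico_le_of_lt_one (by norm_num) (by norm_num)
    _ = f n t * (3 * (2 / 3) ^ n) := by ring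

theorem le_three_mul_potential (H : DyadicCascade a b f J D) {n N : ℕ} (hnN : n ≤ N) {t : ℝ}
    (ht : t ∈ Icc a b) : f n t ≤ 3 * potential f n N t := by
  have hsingle : (2 / 3) ^ n * f n t ≤ ∑ k ∈ Finset.Ico n (N + 1), (2 / 3) ^ k * f k t :=
    Finset.single_le_sum (f := fun k => (2 / 3 : ℝ) ^ k * f k t)
      (fun k _ => mul_nonneg (by positivity) (H.nonneg k t ht))
      (Finset.mem_Ico.2 ⟨le_rfl, Nat.lt_succ_of_le hnN⟩)
  calc f n t = 3 * ((2 / 3) ^ n * f n t / (3 * (2 / 3) ^ n)) := by field_simp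
    _ ≤ 3 * potential f n N t := by unfold potential; gcongr

theorem monotoneOn_potential (H : DyadicCascade a b f J D) (n N : ℕ) :
    MonotoneOn (potential f n N) (Icc a b) := by
  intro s hs t ht hst
  unfold potential
  gcongr with k
  exact H.monotoneOn k hs ht hst

theorem absolutelyContinuous_potential (H : DyadicCascade a b f J D) (n N : ℕ) :
    AbsolutelyContinuousOnInterval (potential f n N) a b := by
  have hsum := absolutelyContinuousOnInterval_sum (Finset.Ico n (N + 1)) fun k _ =>
    (H.absolutelyContinuous k).const_mul ((2 / 3) ^ k)
  convert hsum.const_mul (3 * (2 / 3) ^ n)⁻¹ using 1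
  exact funext fun t => div_eq_inv_mul _ _

theorem hasDerivAt_potential (H : DyadicCascade a b f J D) (n N : ℕ) :
    ∀ᵐ u, u ∈ Ioo a b → HasDerivAt (potential f n N) (potential D n N u) u := by
  filter_upwards [ae_all_iff.2 H.hasDerivAt] with u hu hmem
  exact (HasDerivAt.fun_sum fun k _ => (hu k hmem).const_mul _).div_const _

theorem sq_sum_mass_le (H : DyadicCascade a b f J D) (n N : ℕ) {u : ℝ} (hu : u ∈ Ioo a b) :
    2 ^ n / 48 * (∑ k ∈ Finset.Ico n (N + 1), J k u) ^ 2 ≤ potential D n N u := by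
  have hcs := sq_sum_Ico_le_geometric (q := 3 / 4) (by norm_num) (by norm_num) n (N + 1)
    fun k => J k u
  have hflux : ∀ k, J k u ^ 2 / (3 / 4) ^ k ≤ 4 * ((2 / 3) ^ k * D k u) := fun k =>
    calc J k u ^ 2 / (3 / 4) ^ k = 4 * ((2 / 3) ^ k * (1 / 4 * 2 ^ k * J k u ^ 2)) := by
          have hk : (2 / 3 : ℝ) ^ k * 2 ^ k * (3 / 4) ^ k = 1 := by
            rw [← mul_pow, ← mul_pow]; norm_num
          rw [div_eq_iff (by positivity)]
          linear_combination -J k u ^ 2 * hk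
      _ ≤ 4 * ((2 / 3) ^ k * D k u) := by gcongr; exact H.diagonal_flux_le k hu
  have hn : (2 : ℝ) ^ n * (3 / 4) ^ n * (2 / 3) ^ n = 1 := by
    rw [← mul_pow, ← mul_pow]; norm_num
  rw [potential, le_div_iff₀ (by positivity)]
  calc 2 ^ n / 48 * (∑ k ∈ Finset.Ico n (N + 1), J k u) ^ 2 * (3 * (2 / 3) ^ n)
      ≤ 2 ^ n / 48 * ((3 / 4) ^ n / (1 - 3 / 4) *
          ∑ k ∈ Finset.Ico n (N + 1), 4 * ((2 / 3) ^ k * D k u)) * (3 * (2 / 3) ^ n) := by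
        gcongr
        refine hcs.trans ?_
        gcongr with k
        exact hflux k
    _ = ∑ k ∈ Finset.Ico n (N + 1), (2 / 3) ^ k * D k u := by
        rw [← Finset.mul_sum]
        linear_combination (∑ k ∈ Finset.Ico n (N + 1), (2 / 3) ^ k * D k u) * hn

theorem potential_sub_le (H : DyadicCascade a b f J D) {n N : ℕ} (hnN : n ≤ N) {t : ℝ}
    (ht : t ∈ Icc a b) :
    potential f n N t - 4 * f N b ≤ ∑ k ∈ Finset.Ico n (N + 1), J k t := by
  have hmono : f N t ≤ f N b := H.monotoneOn N ht (right_mem_Icc.2 (ht.1.trans ht.2)) ht.2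
  linarith [H.le_sum t ht n N hnN, H.potential_le n N ht]

theorem potential_riccati (H : DyadicCascade a b f J D) {n N : ℕ} (hnN : n ≤ N) {s : ℝ}
    (hs : s ∈ Icc a b) (hpos : 0 < potential f n N s - 4 * f N b) :
    2 ^ n / 48 * (b - s) * (potential f n N s - 4 * f N b) ≤ 1 := by
  have hsub : uIcc s b ⊆ uIcc a b := by
    rw [uIcc_of_le hs.2, uIcc_of_le (hs.1.trans hs.2)]
    exact Icc_subset_Icc_left hs.1
  have hac : AbsolutelyContinuousOnInterval (fun t => potential f n N t - 4 * f N b) s b :=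
    ((H.absolutelyContinuous_potential n N).mono hsub).sub
      (LipschitzWith.const _).lipschitzOnWith.absolutelyContinuousOnInterval
  refine riccati_bound hs.2 (by positivity) hac hpos ?_
  filter_upwards [H.hasDerivAt_potential n N] with u hu hmem
  have hu' : u ∈ Ioo a b := ⟨hs.1.trans_lt hmem.1, hmem.2⟩
  refine ⟨_, (hu hu').sub_const _, le_trans ?_ (H.sq_sum_mass_le n N hu')⟩
  have hle : potential f n N s ≤ potential f n N u :=
    H.monotoneOn_potential n N hs (Ioo_subset_Icc_self hu') hmem.1.le
  gcongr
  · linarith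
  · exact H.potential_sub_le hnN (Ioo_subset_Icc_self hu')

theorem density_le (H : DyadicCascade a b f J D) (n : ℕ) {s : ℝ} (hs : s ∈ Ico a b) :
    2 ^ n * f n s ≤ 144 / (b - s) := by
  have hbs : 0 < b - s := sub_pos.2 hs.2
  have hcutoff : ∀ N, n ≤ N → 2 ^ n * f n s ≤ 144 / (b - s) + 12 * 2 ^ n * f N b := by
    intro N hnN
    set Y := potential f n N s - 4 * f N b
    have hY_le : 2 ^ n * Y ≤ 48 / (b - s) := by
      rw [le_div_iff₀ hbs]
      rcases le_or_gt Y 0 with hneg | hpos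
      · have : 2 ^ n * Y * (b - s) ≤ 0 :=
          mul_nonpos_of_nonpos_of_nonneg (mul_nonpos_of_nonneg_of_nonpos (by positivity) hneg)
            hbs.le
        linarith
      · linarith [H.potential_riccati hnN (Ico_subset_Icc_self hs) hpos]
    have hf_le : f n s ≤ 3 * Y + 12 * f N b := by
      linarith [H.le_three_mul_potential hnN (Ico_subset_Icc_self hs)]
    calc 2 ^ n * f n s ≤ 2 ^ n * (3 * Y + 12 * f N b) := by gcongr
      _ = 3 * (2 ^ n * Y) + 12 * 2 ^ n * f N b := by ring
      _ ≤ 3 * (48 / (b - s)) + 12 * 2 ^ n * f N b := by gcongr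
      _ = 144 / (b - s) + 12 * 2 ^ n * f N b := by ring
  have hlim : Tendsto (fun N => 144 / (b - s) + 12 * 2 ^ n * f N b) atTop (𝓝 (144 / (b - s))) := by
    simpa using (H.tendsto_zero.const_mul (12 * 2 ^ n)).const_add (144 / (b - s))
  exact ge_of_tendsto hlim (eventually_atTop.2 ⟨n, hcutoff⟩)

theorem card_mul_le_sum_density (H : DyadicCascade a b f J D) {N : ℕ} {g K u : ℝ}
    (hu : u ∈ Icc a b) (hg : ∀ n, g ≤ 2 ^ n * f n u) (hK : 2 ^ N * f N u ≤ K) :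
    (N + 1) * g ≤ 2 * ∑ k ∈ Finset.range (N + 1), 2 ^ k * J k u + 8 * K := by
  have hcount := sum_two_pow_mul_le (f := fun n => f n u) (J := fun k => J k u)
    (r := 4 * f N u) (L := N + 1) (mul_nonneg (by norm_num) (H.nonneg N u hu))
    (fun k => H.mass_nonneg k u) fun n hn => H.le_sum u hu n N (Nat.lt_succ_iff.1 hn)
  calc (N + 1) * g = ∑ _ ∈ Finset.range (N + 1), g := by simp
    _ ≤ ∑ n ∈ Finset.range (N + 1), 2 ^ n * f n u := by gcongr with n; exact hg n
    _ ≤ 2 * ∑ k ∈ Finset.range (N + 1), 2 ^ k * J k u + 8 * (2 ^ N * f N u) := by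
      refine hcount.trans_eq ?_
      ring
    _ ≤ _ := by gcongr

theorem card_mul_sq_le_flux (H : DyadicCascade a b f J D) {N : ℕ} {g K u : ℝ}
    (hu : u ∈ Ioo a b) (hg0 : 0 ≤ g) (hg : ∀ n, g ≤ 2 ^ n * f n u) (hK : 2 ^ N * f N u ≤ K)
    (hN : 16 * K ≤ (N + 1) * g) : (N + 1) * g ^ 2 / 64 * (1 / 2) ^ N ≤ D N u := by
  have hdensity : (N + 1) * g / 4 ≤ ∑ k ∈ Finset.range (N + 1), 2 ^ k * J k u := by
    linarith [H.card_mul_le_sum_density (Ioo_subset_Icc_self hu) hg hK]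
  have hcs : ((N + 1) * g / 4) ^ 2 ≤
      (N + 1) * ∑ k ∈ Finset.range (N + 1), (2 ^ k * J k u) ^ 2 :=
    calc ((N + 1) * g / 4) ^ 2 ≤ (∑ k ∈ Finset.range (N + 1), 2 ^ k * J k u) ^ 2 := by gcongr
      _ ≤ _ := by
        simpa using sq_sum_le_card_mul_sum_sq (s := Finset.range (N + 1))
          (f := fun k => 2 ^ k * J k u)
  have hsq : (N + 1) * g ^ 2 / 16 ≤ ∑ k ∈ Finset.range (N + 1), (2 ^ k * J k u) ^ 2 := by
    refine le_of_mul_le_mul_left ?_ (N.cast_add_one_pos (α := ℝ))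
    linarith
  calc (N + 1) * g ^ 2 / 64 * (1 / 2) ^ N
      = 1 / 4 * (1 / 2) ^ N * ((N + 1) * g ^ 2 / 16) := by ring
    _ ≤ 1 / 4 * (1 / 2) ^ N * ∑ k ∈ Finset.range (N + 1), (2 ^ k * J k u) ^ 2 := by gcongr
    _ ≤ D N u := H.flux_le N u hu

theorem le_density_of_source (H : DyadicCascade a b f J D) {c t : ℝ}
    (hsource : ∀ n, ∀ u ∈ Ioo a b, c * (1 / 2) ^ n ≤ D n u) (n : ℕ) (ht : t ∈ Icc a b) :
    c * (t - a) ≤ 2 ^ n * f n t := by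
  have hab : a ≤ b := ht.1.trans ht.2
  have hgrowth := H.le_sub n le_rfl ht.1 ht.2 fun u hu =>
    hsource n u ⟨hu.1, hu.2.trans_le ht.2⟩
  have hnonneg := H.nonneg n a (left_mem_Icc.2 hab)
  calc c * (t - a) = 2 ^ n * (c * (1 / 2) ^ n * (t - a)) := by rw [one_div_pow]; field_simp
    _ ≤ 2 ^ n * f n t := by gcongr; linarith

theorem false_of_source (H : DyadicCascade a b f J D) (hab : a < b) {c : ℝ} (hc : 0 < c)
    (hsource : ∀ n, ∀ u ∈ Ioo a b, c * (1 / 2) ^ n ≤ D n u) : False := by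
  obtain ⟨p, hap, hpb⟩ := exists_between hab
  obtain ⟨q, hpq, hqb⟩ := exists_between hpb
  set g := c * (p - a) with hg
  set K := 144 / (b - q) with hK
  have hgpos : 0 < g := mul_pos hc (sub_pos.2 hap)
  have hlower : ∀ n, ∀ u ∈ Icc p q, g ≤ 2 ^ n * f n u := fun n u hu =>
    le_trans (by rw [hg]; gcongr; exact hu.1)
      (H.le_density_of_source hsource n ⟨hap.le.trans hu.1, hu.2.trans hqb.le⟩)
  have hupper : ∀ n, ∀ u ∈ Icc p q, 2 ^ n * f n u ≤ K := fun n u hu =>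
    (H.density_le n ⟨hap.le.trans hu.1, hu.2.trans_lt hqb⟩).trans <| by
      rw [hK]
      have := sub_pos.2 hqb
      gcongr
      exact hu.2
  obtain ⟨N, hN⟩ := exists_nat_gt (max (16 * K / g) (64 * K / (g ^ 2 * (q - p))))
  have hN_card : 16 * K ≤ (N + 1) * g := by
    have := (div_lt_iff₀ hgpos).1 ((le_max_left _ _).trans_lt hN)
    linarith
  have hN_time : 64 * K < N * (g ^ 2 * (q - p)) :=
    (div_lt_iff₀ (mul_pos (by positivity) (sub_pos.2 hpq))).1 ((le_max_right _ _).trans_lt hN)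
  have hgrowth := H.le_sub N hap.le hpq.le hqb.le fun u hu =>
    H.card_mul_sq_le_flux ⟨hap.trans hu.1, hu.2.trans hqb⟩ hgpos.le
      (fun n => hlower n u (Ioo_subset_Icc_self hu)) (hupper N u (Ioo_subset_Icc_self hu)) hN_card
  have hmass := H.nonneg N p ⟨hap.le, hpb.le⟩
  have hdense : (N + 1) * g ^ 2 / 64 * (q - p) ≤ K :=
    calc (N + 1) * g ^ 2 / 64 * (q - p)
        = 2 ^ N * ((N + 1) * g ^ 2 / 64 * (1 / 2) ^ N * (q - p)) := by
          rw [one_div_pow]; field_simp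
      _ ≤ 2 ^ N * f N q := by gcongr; linarith
      _ ≤ K := hupper N q (right_mem_Icc.2 hpq.le)
  have : 0 ≤ g ^ 2 * (q - p) := mul_nonneg (by positivity) (sub_nonneg.2 hpq.le)
  linarith

end DyadicCascade

theorem IsC1b.lipschitzOnWith {φ : ℝ → ℝ} (hφ : IsC1b φ) :
    ∃ K : ℝ≥0, LipschitzOnWith K φ (Ici 0) := by
  obtain ⟨hdiff, -, C, hC⟩ := hφ
  refine ⟨C.toNNReal, (convex_Ici 0).lipschitzOnWith_of_nnnorm_derivWithin_le
    (hdiff.differentiableOn one_ne_zero) fun x hx => ?_⟩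
  rw [← NNReal.coe_le_coe, coe_nnnorm]
  exact (hC x hx).trans (Real.le_coe_toNNReal C)

theorem IsC1b.continuous_comp_coe {φ : ℝ → ℝ} (hφ : IsC1b φ) :
    Continuous fun x : ℝ≥0 => φ x :=
  hφ.1.continuousOn.comp_continuous NNReal.continuous_coe fun x => x.2

theorem IsC1b.integrable {φ : ℝ → ℝ} (hφ : IsC1b φ) (μ : Measure ℝ≥0) [IsFiniteMeasure μ] :
    Integrable (fun x : ℝ≥0 => φ x) μ := by
  obtain ⟨C, hC⟩ := hφ.2.1
  exact .of_bound hφ.continuous_comp_coe.aestronglyMeasurable C (.of_forall fun x => hC x x.2)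

theorem Lam_comm (φ : ℝ → ℝ) (x y : ℝ) : Lam φ x y = Lam φ y x := by
  rw [Lam, Lam, add_comm x y, abs_sub_comm, max_comm]

theorem Lam_of_le (φ : ℝ → ℝ) {x y : ℝ} (h : y ≤ x) :
    Lam φ x y = φ (x + y) + φ (x - y) - 2 * φ x := by
  rw [Lam, abs_of_nonneg (sub_nonneg.2 h), max_eq_left h]

theorem Lam_nonneg {φ : ℝ → ℝ} (hφ : ConvexOn ℝ (Ici 0) φ) {x y : ℝ} (hx : 0 ≤ x) (hy : 0 ≤ y) :
    0 ≤ Lam φ x y := by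
  wlog h : y ≤ x generalizing x y
  · rw [Lam_comm]
    exact this hy hx (le_of_not_ge h)
  have hmid := hφ.2 (show x + y ∈ Ici 0 from add_nonneg hx hy)
    (show x - y ∈ Ici 0 from sub_nonneg.2 h)
    (by norm_num : (0 : ℝ) ≤ 1 / 2) (by norm_num : (0 : ℝ) ≤ 1 / 2) (by norm_num)
  have hx_eq : (1 / 2 : ℝ) • (x + y) + (1 / 2 : ℝ) • (x - y) = x := by
    simp only [smul_eq_mul]; ring
  rw [hx_eq, smul_eq_mul, smul_eq_mul] at hmid
  rw [Lam_of_le φ h]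
  linarith

theorem min_le_sqrt_mul {x y : ℝ} (hx : 0 ≤ x) (hy : 0 ≤ y) : min x y ≤ √(x * y) := by
  refine Real.le_sqrt_of_sq_le ?_
  rw [sq]
  exact mul_le_mul (min_le_left _ _) (min_le_right _ _) (le_min hx hy) hx

theorem abs_Lam_le {φ : ℝ → ℝ} {K : ℝ≥0} (hφ : LipschitzOnWith K φ (Ici 0)) {x y : ℝ}
    (hx : 0 ≤ x) (hy : 0 ≤ y) : |Lam φ x y| ≤ 2 * K * √(x * y) := by
  wlog h : y ≤ x generalizing x y
  · rw [Lam_comm, mul_comm x]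
    exact this hy hx (le_of_not_ge h)
  have hadd : |φ (x + y) - φ x| ≤ K * y := by
    simpa [Real.dist_eq, abs_of_nonneg hy] using hφ.dist_le_mul (x + y) (add_nonneg hx hy) x hx
  have hsub : |φ (x - y) - φ x| ≤ K * y := by
    simpa [Real.dist_eq, abs_of_nonneg hy] using hφ.dist_le_mul (x - y) (sub_nonneg.2 h) x hx
  calc |Lam φ x y| = |(φ (x + y) - φ x) + (φ (x - y) - φ x)| := by
        rw [Lam_of_le φ h]; ring_nf
    _ ≤ K * y + K * y := (abs_add_le _ _).trans (add_le_add hadd hsub)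
    _ = 2 * K * min x y := by rw [min_eq_right h]; ring
    _ ≤ 2 * K * √(x * y) := by gcongr; exact min_le_sqrt_mul hx hy

theorem IsC1b.integrable_Lam {φ : ℝ → ℝ} (hφ : IsC1b φ) (μ : Measure (ℝ≥0 × ℝ≥0))
    [IsFiniteMeasure μ] :
    Integrable (fun p : ℝ≥0 × ℝ≥0 => Lam φ p.1 p.2 / √((p.1 : ℝ) * p.2)) μ := by
  obtain ⟨K, hK⟩ := hφ.lipschitzOnWith
  have hcont : Continuous fun p : ℝ≥0 × ℝ≥0 => Lam φ p.1 p.2 := by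
    have hφ_comp : ∀ {g : ℝ≥0 × ℝ≥0 → ℝ}, Continuous g → (∀ p, 0 ≤ g p) →
        Continuous fun p => φ (g p) := fun hg h0 => hφ.1.continuousOn.comp_continuous hg h0
    exact ((hφ_comp (by fun_prop) fun p => by positivity).add
      (hφ_comp (by fun_prop) fun p => abs_nonneg _)).sub
      ((hφ_comp (by fun_prop) fun p => le_max_of_le_left p.1.2).const_mul 2)
  refine .of_bound (hcont.measurable.div (by fun_prop)).aestronglyMeasurable (2 * K)
    (.of_forall fun p => ?_)
  rw [norm_div, Real.norm_eq_abs, Real.norm_of_nonneg (Real.sqrt_nonneg _)]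
  exact div_le_of_le_mul₀ (Real.sqrt_nonneg _) (by positivity) (abs_Lam_le hK p.1.2 p.2.2)

theorem mul_le_neg_calL {φ : ℝ → ℝ} (hanti : AntitoneOn φ (Ici 0)) (hnonneg : ∀ x ∈ Ici 0, 0 ≤ φ x)
    {x z : ℝ} (hz : 0 ≤ z) (hzx : z ≤ x) : z * φ z ≤ -calL φ x := by
  have hint : ∀ {a b}, 0 ≤ a → a ≤ b → IntervalIntegrable φ volume a b := fun ha hab =>
    (hanti.mono (by rw [uIcc_of_le hab]; exact fun y hy => ha.trans hy.1)).intervalIntegrable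
  have hle : ∀ {a b}, 0 ≤ a → a ≤ b → (b - a) * φ b ≤ ∫ y in a..b, φ y := fun {a b} ha hab => by
    simpa using intervalIntegral.integral_mono_on hab intervalIntegrable_const (hint ha hab)
      fun y hy => hanti (ha.trans hy.1) (ha.trans hab) hy.2
  have h0x_int : x * φ x ≤ ∫ y in (0 : ℝ)..x, φ y := by simpa using hle le_rfl (hz.trans hzx)
  have h0z_int : z * φ z ≤ ∫ y in (0 : ℝ)..z, φ y := by simpa using hle le_rfl hz
  have hzx_int : 0 ≤ ∫ y in z..x, φ y :=
    intervalIntegral.integral_nonneg hzx fun y hy => hnonneg y (hz.trans hy.1)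
  have hsplit := intervalIntegral.integral_add_adjacent_intervals (hint le_rfl hz) (hint hz hzx)
  rw [calL]
  linarith

theorem hasDerivAt_max_zero_sq (u : ℝ) :
    HasDerivAt (fun v : ℝ => max v 0 ^ 2) (2 * max u 0) u := by
  have hquad : ∀ v : ℝ, |max v 0 ^ 2 - max u 0 ^ 2 - (v - u) * (2 * max u 0)| ≤ (v - u) ^ 2 := by
    intro v
    rw [abs_le]
    rcases le_total v 0 with hv | hv <;> rcases le_total u 0 with hu | hu <;>
      simp only [max_eq_left, max_eq_right, hv, hu] <;> constructor <;> nlinarith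
  rw [hasDerivAt_iff_isLittleO]
  refine Asymptotics.IsBigO.trans_isLittleO (g := fun v => ‖v - u‖ ^ 2)
    (.of_bound' (.of_forall fun v => ?_)) (Asymptotics.isLittleO_pow_sub_sub u one_lt_two)
  simpa using hquad v

/-- The convex test function `(1 - c x)₊²`, a `C¹` cutoff of the origin at the scale `1 / c`. -/
noncomputable def bump (c x : ℝ) : ℝ := max (1 - c * x) 0 ^ 2

theorem bump_nonneg (c x : ℝ) : 0 ≤ bump c x := sq_nonneg _

theorem bump_zero (c : ℝ) : bump c 0 = 1 := by simp [bump]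

theorem bump_eq_zero {c x : ℝ} (h : 1 ≤ c * x) : bump c x = 0 := by
  rw [bump, max_eq_right (by linarith), zero_pow two_ne_zero]

theorem bump_of_le {c x : ℝ} (h : c * x ≤ 1) : bump c x = (1 - c * x) ^ 2 := by
  rw [bump, max_eq_left (by linarith)]

theorem quarter_le_bump {c x : ℝ} (h : c * x ≤ 1 / 2) : 1 / 4 ≤ bump c x := by
  rw [bump_of_le (by linarith)]
  nlinarith

theorem bump_antitone {c : ℝ} (hc : 0 ≤ c) : Antitone (bump c) := fun x y hxy => by
  unfold bump
  gcongr

theorem bump_antitone_scale {x : ℝ} (hx : 0 ≤ x) : Antitone fun c => bump c x := fun c d hcd => by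
  simp only [bump]
  gcongr

theorem bump_le_one {c x : ℝ} (hc : 0 ≤ c) (hx : 0 ≤ x) : bump c x ≤ 1 :=
  (bump_antitone hc hx).trans_eq (bump_zero c)

theorem continuous_bump (c : ℝ) : Continuous (bump c) := by
  unfold bump
  fun_prop

theorem convexOn_bump (c : ℝ) (s : Set ℝ) (hs : Convex ℝ s) : ConvexOn ℝ s (bump c) := by
  have haffine : ConvexOn ℝ s fun x => 1 - c * x := by
    refine ⟨hs, fun x _ y _ a b _ _ hab => le_of_eq ?_⟩
    simp only [smul_eq_mul]
    linear_combination -hab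
  exact (haffine.sup (convexOn_const 0 hs)).pow (fun x _ => le_max_right _ _) 2

theorem hasDerivAt_bump (c x : ℝ) : HasDerivAt (bump c) (-(2 * c * max (1 - c * x) 0)) x := by
  have haffine : HasDerivAt (fun x : ℝ => 1 - c * x) (-c) x := by
    simpa using ((hasDerivAt_id x).const_mul c).const_sub 1
  refine ((hasDerivAt_max_zero_sq (1 - c * x)).comp x haffine).congr_deriv ?_
  ring

theorem isC1b_of_hasDerivAt {φ φ' : ℝ → ℝ} {C C' : ℝ} (hderiv : ∀ x, HasDerivAt φ (φ' x) x)
    (hcont : Continuous φ') (hφ : ∀ x, 0 ≤ x → |φ x| ≤ C) (hφ' : ∀ x, 0 ≤ x → |φ' x| ≤ C') :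
    IsC1b φ := by
  have hderiv_eq : deriv φ = φ' := funext fun x => (hderiv x).deriv
  refine ⟨(contDiff_one_iff_deriv.2 ⟨fun x => (hderiv x).differentiableAt, ?_⟩).contDiffOn,
    ⟨C, hφ⟩, C', fun x hx => ?_⟩
  · rwa [hderiv_eq]
  · rw [(hderiv x).hasDerivWithinAt.derivWithin (uniqueDiffOn_Ici 0 x hx)]
    exact hφ' x hx

theorem isC1b_one : IsC1b fun _ => 1 :=
  isC1b_of_hasDerivAt (C := 1) (C' := 0) (fun x => hasDerivAt_const x 1) continuous_const
    (fun _ _ => by simp) (fun _ _ => by simp)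

theorem isC1b_bump {c : ℝ} (hc : 0 ≤ c) : IsC1b (bump c) := by
  refine isC1b_of_hasDerivAt (C := 1) (C' := 2 * c) (hasDerivAt_bump c) (by fun_prop)
    (fun x hx => ?_) fun x hx => ?_
  · rw [abs_of_nonneg (bump_nonneg c x)]
    exact bump_le_one hc hx
  · rw [abs_neg, abs_of_nonneg (by positivity)]
    exact mul_le_of_le_one_right (by positivity)
      (max_le (sub_le_self 1 (mul_nonneg hc hx)) zero_le_one)

theorem quarter_le_Lam_bump {c x y : ℝ} (hx : 1 / 2 ≤ c * x) (hy : 1 / 2 ≤ c * y)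
    (hxy : c * |x - y| ≤ 1 / 2) : 1 / 4 ≤ Lam (bump c) x y := by
  wlog h : y ≤ x generalizing x y
  · rw [Lam_comm]
    exact this hy hx (by rwa [abs_sub_comm]) (le_of_not_ge h)
  rw [abs_of_nonneg (sub_nonneg.2 h)] at hxy
  rw [Lam_of_le _ h, bump_eq_zero (by linarith : 1 ≤ c * (x + y)), zero_add]
  rcases le_total 1 (c * x) with hcx | hcx
  · rw [bump_eq_zero hcx]
    linarith [quarter_le_bump hxy]
  · rw [bump_of_le (by linarith : c * (x - y) ≤ 1), bump_of_le hcx]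
    nlinarith

theorem neg_calL_bump_le {c x : ℝ} (hc : 0 < c) (hx : 0 ≤ x) :
    -calL (bump c) x ≤ 2 * min x c⁻¹ := by
  have hint : ∀ a b, IntervalIntegrable (bump c) volume a b := fun a b =>
    (continuous_bump c).intervalIntegrable a b
  have hcalL : -calL (bump c) x ≤ 2 * ∫ y in (0 : ℝ)..x, bump c y := by
    rw [calL]
    linarith [mul_nonneg hx (bump_nonneg c x)]
  refine hcalL.trans ?_
  gcongr
  have hle : ∀ z, 0 ≤ z → ∫ y in (0 : ℝ)..z, bump c y ≤ z := fun z hz => by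
    simpa using intervalIntegral.integral_mono_on hz (hint 0 z) intervalIntegrable_const
      fun y hy => bump_le_one hc.le hy.1
  rcases le_total x c⁻¹ with h | h
  · rw [min_eq_left h]
    exact hle x hx
  · rw [min_eq_right h,
      ← intervalIntegral.integral_add_adjacent_intervals (hint 0 c⁻¹) (hint c⁻¹ x)]
    have htail : ∫ y in c⁻¹..x, bump c y = ∫ _ in c⁻¹..x, (0 : ℝ) :=
      intervalIntegral.integral_congr fun y hy => by
        rw [uIcc_of_le h] at hy
        exact bump_eq_zero (by simpa [hc.ne'] using mul_le_mul_of_nonneg_left hy.1 hc.le)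
    rw [htail, intervalIntegral.integral_zero, add_zero]
    exact hle _ (by positivity)

theorem continuous_calL {φ : ℝ → ℝ} (hφ : Continuous φ) : Continuous (calL φ) := by
  unfold calL
  exact (continuous_id.mul hφ).sub ((intervalIntegral.continuous_primitive
    (fun a b => hφ.intervalIntegrable a b) 0).const_mul 2)

theorem calL_bump_nonpos {c x : ℝ} (hc : 0 ≤ c) (hx : 0 ≤ x) : calL (bump c) x ≤ 0 := by
  simpa using mul_le_neg_calL ((bump_antitone hc).antitoneOn _) (fun y _ => bump_nonneg c y)
    le_rfl hx

theorem integrable_calL_bump (μ : Measure ℝ≥0) [IsFiniteMeasure μ] {c : ℝ} (hc : 0 < c) :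
    Integrable (fun x : ℝ≥0 => calL (bump c) x / √x) μ := by
  have hmeas : Measurable fun x : ℝ≥0 => calL (bump c) x / √x :=
    ((continuous_calL (continuous_bump c)).measurable.comp measurable_coe_nnreal_real).div
      (by fun_prop)
  refine .of_bound hmeas.aestronglyMeasurable (2 * √c⁻¹) (.of_forall fun x => ?_)
  rw [norm_div, Real.norm_of_nonneg (Real.sqrt_nonneg _),
    Real.norm_of_nonpos (calL_bump_nonpos hc.le x.coe_nonneg)]
  refine div_le_of_le_mul₀ (Real.sqrt_nonneg _) (by positivity) ?_
  calc -calL (bump c) x ≤ 2 * min (x : ℝ) c⁻¹ := neg_calL_bump_le hc x.2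
    _ ≤ 2 * √(x * c⁻¹) := by gcongr; exact min_le_sqrt_mul x.2 (by positivity)
    _ = 2 * √c⁻¹ * √x := by rw [Real.sqrt_mul x.coe_nonneg]; ring

theorem mul_exp_neg_le_one {r x : ℝ} (h : r ≤ Real.exp x) : r * Real.exp (-x) ≤ 1 := by
  rwa [Real.exp_neg, ← div_eq_mul_inv, div_le_one (Real.exp_pos x)]

/-- The test function `x e⁻ˣ`: it is positive exactly away from the origin, so its integral detects
the mass of a measure on `(0, ∞)`. -/
noncomputable def mulExpNeg (x : ℝ) : ℝ := x * Real.exp (-x)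

theorem mulExpNeg_nonneg {x : ℝ} (hx : 0 ≤ x) : 0 ≤ mulExpNeg x :=
  mul_nonneg hx (Real.exp_pos _).le

theorem hasDerivAt_mulExpNeg (x : ℝ) : HasDerivAt mulExpNeg ((1 - x) * Real.exp (-x)) x := by
  refine ((hasDerivAt_id x).mul (hasDerivAt_neg x).exp).congr_deriv ?_
  simp only [id]
  ring

theorem continuous_mulExpNeg : Continuous mulExpNeg := by
  unfold mulExpNeg
  fun_prop

theorem isC1b_mulExpNeg : IsC1b mulExpNeg := by
  have hexp : ∀ x : ℝ, (x + 1) * Real.exp (-x) ≤ 1 := fun x =>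
    mul_exp_neg_le_one (Real.add_one_le_exp x)
  refine isC1b_of_hasDerivAt (C := 1) (C' := 1) hasDerivAt_mulExpNeg (by fun_prop)
    (fun x hx => ?_) fun x hx => ?_
  · rw [abs_of_nonneg (mulExpNeg_nonneg hx), mulExpNeg]
    linarith [hexp x, Real.exp_pos (-x)]
  · rw [abs_mul, Real.abs_exp]
    have : |1 - x| ≤ x + 1 := abs_le.2 ⟨by linarith, by linarith⟩
    exact (mul_le_mul_of_nonneg_right this (Real.exp_pos _).le).trans (hexp x)

theorem integral_mulExpNeg (x : ℝ) :
    ∫ y in (0 : ℝ)..x, mulExpNeg y = 1 - (1 + x) * Real.exp (-x) := by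
  have hderiv : ∀ y, HasDerivAt (fun y => -((1 + y) * Real.exp (-y))) (mulExpNeg y) y := fun y => by
    refine (((hasDerivAt_id y).const_add 1).mul (hasDerivAt_neg y).exp).neg.congr_deriv ?_
    simp only [id, mulExpNeg]
    ring
  rw [intervalIntegral.integral_eq_sub_of_hasDerivAt (fun y _ => hderiv y)
    (continuous_mulExpNeg.intervalIntegrable _ _)]
  simp only [add_zero, neg_zero, Real.exp_zero]
  ring

theorem calL_mulExpNeg_nonpos {x : ℝ} (hx : 0 ≤ x) : calL mulExpNeg x ≤ 0 := by
  have hcalL : calL mulExpNeg x = 2 * ((1 + x + x ^ 2 / 2) * Real.exp (-x) - 1) := by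
    rw [calL, integral_mulExpNeg, mulExpNeg]
    ring
  have hquad : (1 + x + x ^ 2 / 2) * Real.exp (-x) ≤ 1 :=
    mul_exp_neg_le_one (Real.quadratic_le_exp_of_nonneg hx)
  linarith

theorem neg_le_Lam_mulExpNeg {x y : ℝ} (hx : 0 ≤ x) (hy : 0 ≤ y) :
    -(3 * (mulExpNeg x + mulExpNeg y) * √(x * y)) ≤ Lam mulExpNeg x y := by
  wlog h : y ≤ x generalizing x y
  · rw [Lam_comm, mul_comm x, add_comm (mulExpNeg x)]
    exact this hy hx (le_of_not_ge h)
  have hsqrt : y ≤ √(x * y) := by simpa [min_eq_right h] using min_le_sqrt_mul hx hy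
  have hφx := mulExpNeg_nonneg hx
  have hφy := mulExpNeg_nonneg hy
  suffices hsuff : -(3 * mulExpNeg x * √(x * y)) ≤ Lam mulExpNeg x y by
    nlinarith [mul_nonneg hφy (Real.sqrt_nonneg (x * y))]
  rw [Lam_of_le _ h]
  rcases le_total 1 y with hy1 | hy1
  · have hadd := mulExpNeg_nonneg (add_nonneg hx hy)
    have hsub := mulExpNeg_nonneg (sub_nonneg.2 h)
    nlinarith [mul_le_mul_of_nonneg_left (hy1.trans hsqrt) hφx]
  · have hLam : mulExpNeg (x + y) + mulExpNeg (x - y) - 2 * mulExpNeg x = Real.exp (-x) *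
        (x * (Real.exp y + Real.exp (-y) - 2) - y * (Real.exp y - Real.exp (-y))) := by
      simp only [mulExpNeg, neg_add, neg_sub, sub_eq_add_neg y x, Real.exp_add]
      ring
    have hcosh : 0 ≤ Real.exp y + Real.exp (-y) - 2 := by
      linarith [Real.add_one_le_exp y, Real.add_one_le_exp (-y)]
    have hsinh : Real.exp y - Real.exp (-y) ≤ 3 * y := by
      have hexp := (le_abs_self _).trans
        (Real.abs_exp_sub_one_le (x := y) (by rwa [abs_of_nonneg hy]))
      rw [abs_of_nonneg hy] at hexp
      linarith [Real.add_one_le_exp (-y)]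
    have hbracket : -(3 * x * √(x * y)) ≤
        x * (Real.exp y + Real.exp (-y) - 2) - y * (Real.exp y - Real.exp (-y)) := by
      have hsq : y * (3 * y) ≤ 3 * x * √(x * y) := by nlinarith
      linarith [mul_nonneg hx hcosh, mul_le_mul_of_nonneg_left hsinh hy]
    rw [hLam]
    calc -(3 * mulExpNeg x * √(x * y)) = Real.exp (-x) * -(3 * x * √(x * y)) := by
          rw [mulExpNeg]; ring
      _ ≤ _ := by gcongr

theorem neg_le_Q32_mulExpNeg (μ : FiniteMeasure ℝ≥0) :
    -(6 * (μ : Measure ℝ≥0).real univ * ∫ x : ℝ≥0, mulExpNeg x ∂(μ : Measure ℝ≥0)) ≤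
      Q32 mulExpNeg μ := by
  set ν : Measure ℝ≥0 := (μ : Measure ℝ≥0)
  have hint := isC1b_mulExpNeg.integrable ν
  have hint_fst : Integrable (fun p : ℝ≥0 × ℝ≥0 => mulExpNeg p.1) (ν.prod ν) := hint.comp_fst _
  have hint_snd : Integrable (fun p : ℝ≥0 × ℝ≥0 => mulExpNeg p.2) (ν.prod ν) := hint.comp_snd _
  have hint_sum := (hint_fst.add hint_snd).const_mul 3
  calc -(6 * ν.real univ * ∫ x : ℝ≥0, mulExpNeg x ∂ν)
      = -∫ p : ℝ≥0 × ℝ≥0, 3 * (mulExpNeg p.1 + mulExpNeg p.2) ∂(ν.prod ν) := by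
        rw [integral_const_mul, integral_add hint_fst hint_snd,
          integral_fun_fst (fun x : ℝ≥0 => mulExpNeg x),
          integral_fun_snd (fun x : ℝ≥0 => mulExpNeg x)]
        simp only [smul_eq_mul]
        ring
    _ ≤ -∫ p in Ioi 0 ×ˢ Ioi 0, 3 * (mulExpNeg p.1 + mulExpNeg p.2) ∂(ν.prod ν) :=
        neg_le_neg (setIntegral_le_integral hint_sum (.of_forall fun p =>
          mul_nonneg zero_le_three (add_nonneg (mulExpNeg_nonneg p.1.2) (mulExpNeg_nonneg p.2.2))))
    _ ≤ Q32 mulExpNeg μ := by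
        rw [← integral_neg]
        refine setIntegral_mono_on hint_sum.neg.integrableOn
          (isC1b_mulExpNeg.integrable_Lam _).integrableOn
          (measurableSet_Ioi.prod measurableSet_Ioi) fun p hp => ?_
        have hpos : 0 < √((p.1 : ℝ) * p.2) :=
          Real.sqrt_pos.2 (mul_pos (NNReal.coe_pos.2 hp.1) (NNReal.coe_pos.2 hp.2))
        rw [le_div_iff₀ hpos, neg_mul]
        exact neg_le_Lam_mulExpNeg p.1.2 p.2.2

theorem neg_le_Q3tilde_mulExpNeg (μ : FiniteMeasure ℝ≥0) :
    -(6 * (μ : Measure ℝ≥0).real univ * ∫ x : ℝ≥0, mulExpNeg x ∂(μ : Measure ℝ≥0)) ≤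
      Q3tilde mulExpNeg μ := by
  have hlinear : Q31tilde mulExpNeg μ ≤ 0 := integral_nonpos fun x =>
    div_nonpos_of_nonpos_of_nonneg (calL_mulExpNeg_nonpos x.2) (Real.sqrt_nonneg _)
  rw [Q3tilde]
  linarith [neg_le_Q32_mulExpNeg μ]

theorem integral_mulExpNeg_pos {μ : Measure ℝ≥0} [IsFiniteMeasure μ] (hμ : 0 < μ (Ioi 0)) :
    0 < ∫ x : ℝ≥0, mulExpNeg x ∂μ := by
  have hsupp : Function.support (fun x : ℝ≥0 => mulExpNeg x) = Ioi 0 := by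
    ext x
    simp [mulExpNeg, pos_iff_ne_zero]
  rwa [integral_pos_iff_support_of_nonneg (fun x => mulExpNeg_nonneg x.2)
    (isC1b_mulExpNeg.integrable μ), hsupp]

theorem mulExpNeg_mul_sqrt_le {x : ℝ} (hx : 0 ≤ x) : mulExpNeg x * √x ≤ min x 1 := by
  have hsqrt_le : √x ≤ (1 + x) / 2 := by nlinarith [sq_nonneg (√x - 1), Real.sq_sqrt hx]
  have hquad := Real.quadratic_le_exp_of_nonneg hx
  refine le_min ?_ ?_
  · calc mulExpNeg x * √x = x * (√x * Real.exp (-x)) := by rw [mulExpNeg]; ring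
      _ ≤ x * 1 := by gcongr; exact mul_exp_neg_le_one (by nlinarith)
      _ = x := mul_one x
  · calc mulExpNeg x * √x = x * √x * Real.exp (-x) := by rw [mulExpNeg]; ring
      _ ≤ 1 := mul_exp_neg_le_one (by nlinarith)

theorem mulExpNeg_le_neg_calL_bump {c x : ℝ} (hc : 1 ≤ c) (hx : 0 ≤ x) :
    1 / (8 * c) * (mulExpNeg x * √x) ≤ -calL (bump c) x := by
  have hc0 : 0 < c := by linarith
  set z := min x (1 / (2 * c)) with hz
  have hz0 : 0 ≤ z := le_min hx (by positivity)
  have hbump : 1 / 4 ≤ bump c z := by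
    refine quarter_le_bump ?_
    calc c * z ≤ c * (1 / (2 * c)) := by gcongr; exact min_le_right _ _
      _ = 1 / 2 := by field_simp
  have hmin : min x 1 ≤ 2 * c * z := by
    rw [hz, mul_min_of_nonneg _ _ (by positivity), mul_one_div_cancel (by positivity)]
    exact min_le_min_right 1 (by nlinarith)
  calc 1 / (8 * c) * (mulExpNeg x * √x) ≤ 1 / (8 * c) * (2 * c * z) := by
        refine mul_le_mul_of_nonneg_left ?_ (by positivity)
        exact (mulExpNeg_mul_sqrt_le hx).trans hmin
    _ = z * (1 / 4) := by field_simp; ring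
    _ ≤ z * bump c z := by gcongr
    _ ≤ -calL (bump c) x := mul_le_neg_calL ((bump_antitone hc0.le).antitoneOn _)
        (fun y _ => bump_nonneg c y) hz0 (min_le_left _ _)

theorem mul_integral_mulExpNeg_le_neg_Q31tilde (μ : FiniteMeasure ℝ≥0) {c : ℝ} (hc : 1 ≤ c) :
    1 / (8 * c) * ∫ x : ℝ≥0, mulExpNeg x ∂(μ : Measure ℝ≥0) ≤ -Q31tilde (bump c) μ := by
  set ν : Measure ℝ≥0 := (μ : Measure ℝ≥0)
  have hsupp : ∫ x : ℝ≥0, mulExpNeg x ∂ν = ∫ x in Ioi (0 : ℝ≥0), mulExpNeg x ∂ν := by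
    refine (setIntegral_eq_integral_of_forall_compl_eq_zero fun x hx => ?_).symm
    obtain rfl : x = 0 := by simpa using hx
    simp [mulExpNeg]
  rw [hsupp, Q31tilde, ← integral_neg, ← integral_const_mul]
  refine setIntegral_mono_on ((isC1b_mulExpNeg.integrable ν).const_mul _).integrableOn
    (integrable_calL_bump ν (by linarith)).neg.integrableOn measurableSet_Ioi fun x hx => ?_
  rw [← neg_div, le_div_iff₀ (Real.sqrt_pos.2 (NNReal.coe_pos.2 hx)), mul_assoc]
  exact mulExpNeg_le_neg_calL_bump hc x.2

theorem sq_measureReal_biUnion_le {α ι : Type*} [MeasurableSpace α] (μ : Measure α)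
    [IsFiniteMeasure μ] {I : Finset ι} {s : ι → Set α} (hs : ∀ i, MeasurableSet (s i))
    (hdisj : (I : Set ι).PairwiseDisjoint s) :
    μ.real (⋃ i ∈ I, s i) ^ 2 ≤ I.card * (μ.prod μ).real (⋃ i ∈ I, s i ×ˢ s i) := by
  have hdisj_prod : (I : Set ι).PairwiseDisjoint fun i => s i ×ˢ s i := fun i hi j hj hij =>
    (hdisj hi hj hij).set_prod_left _ _
  rw [measureReal_biUnion_finset hdisj fun i _ => hs i,
    measureReal_biUnion_finset hdisj_prod fun i _ => (hs i).prod (hs i)]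
  simp only [measureReal_prod_prod, ← sq]
  exact sq_sum_le_card_mul_sum_sq

theorem two_pow_mul_half_pow {K : Type*} [Semifield K] [NeZero (2 : K)] (n : ℕ) :
    (2 : K) ^ n * (1 / 2) ^ n = 1 := by
  rw [← mul_pow, mul_one_div_cancel two_ne_zero, one_pow]

/-- The dyadic shell `(2⁻⁽ᵏ⁺¹⁾, 2⁻ᵏ]`. -/
noncomputable def shell (k : ℕ) : Set ℝ≥0 := Ioc ((1 / 2) ^ (k + 1)) ((1 / 2) ^ k)

/-- The `j`-th interval `(j ε, (j + 1) ε]` of the partition of `(0, ∞)` with mesh `ε`. -/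
def cell (ε : ℝ≥0) (j : ℕ) : Set ℝ≥0 := Ioc (j * ε) ((j + 1) * ε)

theorem cell_eq_Ioc_succ (ε : ℝ≥0) :
    cell ε = fun j : ℕ => Ioc ((j : ℝ≥0) * ε) ((Order.succ j : ℕ) * ε) := by
  funext j
  rw [cell, Order.succ_eq_add_one, Nat.cast_add_one]

theorem monotone_natCast_mul (ε : ℝ≥0) : Monotone fun j : ℕ => (j : ℝ≥0) * ε := fun i j hij => by
  beta_reduce
  gcongr

theorem pairwiseDisjoint_cell (ε : ℝ≥0) (s : Set ℕ) : s.PairwiseDisjoint (cell ε) := by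
  rw [cell_eq_Ioc_succ]
  exact (monotone_natCast_mul ε).pairwise_disjoint_on_Ioc_succ.set_pairwise s

theorem biUnion_cell (ε : ℝ≥0) (m n : ℕ) :
    ⋃ j ∈ Finset.Ico m n, cell ε j = Ioc (m * ε) (n * ε) := by
  simpa only [cell_eq_Ioc_succ, Finset.mem_Ico, mem_Ico] using
    (monotone_natCast_mul ε).biUnion_Ico_Ioc_map_succ m n

theorem biUnion_cell_eq_shell {k n : ℕ} (hk : k ≤ n) :
    ⋃ j ∈ Finset.Ico (2 ^ (n - k)) (2 ^ (n - k + 1)), cell ((1 / 2) ^ (n + 1)) j = shell k := by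
  obtain ⟨d, rfl⟩ := Nat.exists_eq_add_of_le hk
  have hscale : ∀ i j : ℕ, (2 : ℝ≥0) ^ i * (1 / 2) ^ (i + j) = (1 / 2) ^ j := fun i j => by
    rw [pow_add, ← mul_assoc, two_pow_mul_half_pow, one_mul]
  rw [biUnion_cell, shell, Nat.add_sub_cancel_left, Nat.cast_pow, Nat.cast_pow, Nat.cast_two,
    show k + d + 1 = d + (k + 1) by ring, hscale, show d + (k + 1) = d + 1 + k by ring, hscale]

theorem abs_sub_le_of_mem_cell {ε : ℝ≥0} {j : ℕ} {x y : ℝ≥0} (hx : x ∈ cell ε j)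
    (hy : y ∈ cell ε j) : |(x : ℝ) - y| ≤ ε := by
  have hbounds : ∀ z ∈ cell ε j, (j : ℝ) * ε < z ∧ (z : ℝ) ≤ (j + 1) * ε := fun z hz =>
    ⟨NNReal.coe_lt_coe.2 hz.1, NNReal.coe_le_coe.2 hz.2⟩
  obtain ⟨hx_gt, hx_le⟩ := hbounds x hx
  obtain ⟨hy_gt, hy_le⟩ := hbounds y hy
  rw [abs_le]
  constructor <;> linarith

theorem le_kernel_of_mem_shell {k n : ℕ} (hk : k ≤ n) {x y : ℝ≥0} (hx : x ∈ shell k)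
    (hy : y ∈ shell k) (hxy : |(x : ℝ) - y| ≤ (1 / 2) ^ (n + 1)) :
    1 / 4 * 2 ^ k ≤ Lam (bump (2 ^ n)) x y / √((x : ℝ) * y) := by
  have hbounds : ∀ z ∈ shell k, (1 / 2 : ℝ) ^ (k + 1) < z ∧ (z : ℝ) ≤ (1 / 2) ^ k := fun z hz => by
    exact_mod_cast hz
  have hhalf : (2 : ℝ) ^ n * (1 / 2) ^ (n + 1) = 1 / 2 := by
    rw [pow_succ, ← mul_assoc, two_pow_mul_half_pow, one_mul]
  have hlower : ∀ z ∈ shell k, (1 / 2 : ℝ) ≤ 2 ^ n * z := fun z hz => by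
    rw [← hhalf]
    have hle : (1 / 2 : ℝ) ^ (n + 1) ≤ (1 / 2) ^ (k + 1) :=
      pow_le_pow_of_le_one (by norm_num) (by norm_num) (by lia)
    gcongr
    exact hle.trans (hbounds z hz).1.le
  have hLam : 1 / 4 ≤ Lam (bump (2 ^ n)) x y :=
    quarter_le_Lam_bump (hlower x hx) (hlower y hy) (by rw [← hhalf]; gcongr)
  have hpos : ∀ z ∈ shell k, (0 : ℝ) < z := fun z hz =>
    lt_trans (by positivity) (hbounds z hz).1
  have hsqrt : √((x : ℝ) * y) ≤ (1 / 2) ^ k := by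
    rw [Real.sqrt_le_left (by positivity), sq]
    exact mul_le_mul (hbounds x hx).2 (hbounds y hy).2 y.coe_nonneg (by positivity)
  rw [le_div_iff₀ (Real.sqrt_pos.2 (mul_pos (hpos x hx) (hpos y hy)))]
  calc 1 / 4 * 2 ^ k * √((x : ℝ) * y) ≤ 1 / 4 * 2 ^ k * (1 / 2) ^ k := by gcongr
    _ = 1 / 4 := by rw [mul_assoc, two_pow_mul_half_pow, mul_one]
    _ ≤ _ := hLam

theorem kernel_bump_nonneg (c : ℝ) (x y : ℝ≥0) :
    0 ≤ Lam (bump c) x y / √((x : ℝ) * y) :=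
  div_nonneg (Lam_nonneg (convexOn_bump c _ (convex_Ici 0)) x.2 y.2) (Real.sqrt_nonneg _)

theorem Q32_bump_nonneg (c : ℝ) (μ : FiniteMeasure ℝ≥0) : 0 ≤ Q32 (bump c) μ :=
  integral_nonneg fun p => kernel_bump_nonneg c p.1 p.2

theorem Q31tilde_bump_nonpos {c : ℝ} (hc : 0 ≤ c) (μ : FiniteMeasure ℝ≥0) :
    Q31tilde (bump c) μ ≤ 0 :=
  integral_nonpos fun x =>
    div_nonpos_of_nonpos_of_nonneg (calL_bump_nonpos hc x.2) (Real.sqrt_nonneg _)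

/-- The union of the squares over the intervals of length `2⁻⁽ⁿ⁺¹⁾` that partition `shell k`: there
the second difference of `bump (2 ^ n)` is bounded below. -/
noncomputable def diagonalStrip (k n : ℕ) : Set (ℝ≥0 × ℝ≥0) :=
  ⋃ j ∈ Finset.Ico (2 ^ (n - k)) (2 ^ (n - k + 1)),
    cell ((1 / 2) ^ (n + 1)) j ×ˢ cell ((1 / 2) ^ (n + 1)) j

theorem measurableSet_diagonalStrip (k n : ℕ) : MeasurableSet (diagonalStrip k n) :=
  Finset.measurableSet_biUnion _ fun _ _ => measurableSet_Ioc.prod measurableSet_Ioc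

theorem diagonalStrip_subset {k n : ℕ} (hk : k ≤ n) : diagonalStrip k n ⊆ shell k ×ˢ shell k := by
  refine iUnion₂_subset fun j hj => ?_
  have hcell : cell ((1 / 2) ^ (n + 1)) j ⊆ shell k := by
    rw [← biUnion_cell_eq_shell hk]
    exact subset_biUnion_of_mem (u := cell _) hj
  exact prod_mono hcell hcell

theorem le_kernel_of_mem_diagonalStrip {k n : ℕ} (hk : k ≤ n) {p : ℝ≥0 × ℝ≥0}
    (hp : p ∈ diagonalStrip k n) :
    1 / 4 * 2 ^ k ≤ Lam (bump (2 ^ n)) p.1 p.2 / √((p.1 : ℝ) * p.2) := by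
  obtain ⟨j, -, hx, hy⟩ := mem_iUnion₂.1 hp
  have hshell := diagonalStrip_subset hk hp
  exact le_kernel_of_mem_shell hk hshell.1 hshell.2
    ((abs_sub_le_of_mem_cell hx hy).trans_eq (by simp))

theorem sq_measure_shell_le (ν : Measure ℝ≥0) [IsFiniteMeasure ν] {k n : ℕ} (hk : k ≤ n) :
    ν.real (shell k) ^ 2 ≤ 2 ^ (n - k) * (ν.prod ν).real (diagonalStrip k n) := by
  have hcard : ((Finset.Ico (2 ^ (n - k)) (2 ^ (n - k + 1))).card : ℝ) = 2 ^ (n - k) := by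
    rw [Nat.card_Ico, pow_succ, mul_two, Nat.add_sub_cancel, Nat.cast_pow, Nat.cast_two]
  rw [← hcard, ← biUnion_cell_eq_shell hk]
  exact sq_measureReal_biUnion_le ν (fun _ => measurableSet_Ioc) (pairwiseDisjoint_cell _ _)

theorem sq_measure_shell_le_integral (ν : Measure ℝ≥0) [IsFiniteMeasure ν] {k n : ℕ}
    (hk : k ≤ n) : 1 / 4 * (1 / 2) ^ n * (2 ^ k * ν.real (shell k)) ^ 2 ≤
      ∫ p in shell k ×ˢ shell k, Lam (bump (2 ^ n)) p.1 p.2 / √((p.1 : ℝ) * p.2) ∂(ν.prod ν) := by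
  have hint := ((isC1b_bump (by positivity : (0 : ℝ) ≤ 2 ^ n)).integrable_Lam (ν.prod ν))
  have hscale : (1 / 2 : ℝ) ^ n * (2 ^ k * 2 ^ (n - k)) = 1 := by
    rw [← pow_add, Nat.add_sub_of_le hk, mul_comm, two_pow_mul_half_pow]
  calc 1 / 4 * (1 / 2) ^ n * (2 ^ k * ν.real (shell k)) ^ 2
      = 1 / 4 * (1 / 2) ^ n * 2 ^ k * 2 ^ k * ν.real (shell k) ^ 2 := by ring
    _ ≤ 1 / 4 * (1 / 2) ^ n * 2 ^ k * 2 ^ k *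
          (2 ^ (n - k) * (ν.prod ν).real (diagonalStrip k n)) := by
        gcongr
        exact sq_measure_shell_le ν hk
    _ = 1 / 4 * 2 ^ k * (ν.prod ν).real (diagonalStrip k n) := by
        linear_combination 1 / 4 * 2 ^ k * (ν.prod ν).real (diagonalStrip k n) * hscale
    _ ≤ ∫ p in diagonalStrip k n,
          Lam (bump (2 ^ n)) p.1 p.2 / √((p.1 : ℝ) * p.2) ∂(ν.prod ν) :=
        setIntegral_ge_of_const_le_real (measurableSet_diagonalStrip k n) (measure_ne_top _ _)
          (fun p hp => le_kernel_of_mem_diagonalStrip hk hp) hint.integrableOn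
    _ ≤ _ := setIntegral_mono_set hint.integrableOn
        (.of_forall fun p => kernel_bump_nonneg _ p.1 p.2) (diagonalStrip_subset hk).eventuallyLE

theorem pairwise_disjoint_shell : Pairwise (Function.onFun Disjoint shell) :=
  Antitone.pairwise_disjoint_on_Ioc_succ (f := fun k : ℕ => (1 / 2 : ℝ≥0) ^ k)
    (pow_right_anti₀ zero_le (by norm_num))

theorem sum_sq_measure_shell_le_Q32 (μ : FiniteMeasure ℝ≥0) (n : ℕ) :
    1 / 4 * (1 / 2) ^ n *
        ∑ k ∈ Finset.range (n + 1), (2 ^ k * (μ : Measure ℝ≥0).real (shell k)) ^ 2 ≤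
      Q32 (bump (2 ^ n)) μ := by
  set ν : Measure ℝ≥0 := (μ : Measure ℝ≥0)
  have hint := (isC1b_bump (by positivity : (0 : ℝ) ≤ 2 ^ n)).integrable_Lam (ν.prod ν)
  have hdisj : Set.Pairwise (Finset.range (n + 1))
      (Function.onFun Disjoint fun k => shell k ×ˢ shell k) := fun i _ j _ hij =>
    (pairwise_disjoint_shell hij).set_prod_left _ _
  have hsub : ⋃ k ∈ Finset.range (n + 1), shell k ×ˢ shell k ⊆ Ioi 0 ×ˢ Ioi 0 :=
    iUnion₂_subset fun k _ => prod_mono (fun x hx => zero_le.trans_lt hx.1)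
      fun x hx => zero_le.trans_lt hx.1
  calc 1 / 4 * (1 / 2) ^ n * ∑ k ∈ Finset.range (n + 1), (2 ^ k * ν.real (shell k)) ^ 2
      ≤ ∑ k ∈ Finset.range (n + 1), ∫ p in shell k ×ˢ shell k,
          Lam (bump (2 ^ n)) p.1 p.2 / √((p.1 : ℝ) * p.2) ∂(ν.prod ν) := by
        rw [Finset.mul_sum]
        exact Finset.sum_le_sum fun k hk =>
          sq_measure_shell_le_integral ν (Nat.lt_succ_iff.1 (Finset.mem_range.1 hk))
    _ = ∫ p in ⋃ k ∈ Finset.range (n + 1), shell k ×ˢ shell k,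
          Lam (bump (2 ^ n)) p.1 p.2 / √((p.1 : ℝ) * p.2) ∂(ν.prod ν) :=
        (integral_biUnion_finset _ (fun k _ => measurableSet_Ioc.prod measurableSet_Ioc) hdisj
          fun k _ => hint.integrableOn).symm
    _ ≤ Q32 (bump (2 ^ n)) μ := setIntegral_mono_set hint.integrableOn
        (.of_forall fun p => kernel_bump_nonneg _ p.1 p.2) hsub.eventuallyLE

theorem integral_bump_sub_atom (ν : Measure ℝ≥0) [IsFiniteMeasure ν] {c : ℝ} (hc : 0 ≤ c) :
    ∫ x : ℝ≥0, bump c x ∂ν - ν.real {0} = ∫ x in Ioi (0 : ℝ≥0), bump c x ∂ν := by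
  have hcompl : ({0}ᶜ : Set ℝ≥0) = Ioi 0 := by
    ext x
    simp [pos_iff_ne_zero]
  rw [← integral_add_compl (measurableSet_singleton (0 : ℝ≥0)) ((isC1b_bump hc).integrable ν),
    integral_singleton, hcompl, NNReal.coe_zero, bump_zero, smul_eq_mul, mul_one,
    add_sub_cancel_left]

theorem measure_zero_le_integral_bump (ν : Measure ℝ≥0) [IsFiniteMeasure ν] {c : ℝ}
    (hc : 0 ≤ c) : ν.real {0} ≤ ∫ x : ℝ≥0, bump c x ∂ν := by
  rw [← sub_nonneg, integral_bump_sub_atom ν hc]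
  exact integral_nonneg fun x => bump_nonneg c x

theorem integral_bump_sub_atom_le_measure (ν : Measure ℝ≥0) [IsFiniteMeasure ν] (n : ℕ) :
    ∫ x : ℝ≥0, bump (2 ^ n) x ∂ν - ν.real {0} ≤ ν.real (Ioc 0 ((1 / 2) ^ n)) := by
  have hc : (0 : ℝ) ≤ 2 ^ n := by positivity
  have hzero : ∀ x ∈ Ioi (0 : ℝ≥0) \ Ioc 0 ((1 / 2) ^ n), bump (2 ^ n) x = 0 := fun x hx => by
    have hx_gt : (1 / 2 : ℝ) ^ n < x := by
      exact_mod_cast not_le.1 fun hle => hx.2 ⟨hx.1, hle⟩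
    refine bump_eq_zero ?_
    calc (1 : ℝ) = 2 ^ n * (1 / 2) ^ n := (two_pow_mul_half_pow n).symm
      _ ≤ 2 ^ n * x := by gcongr
  rw [integral_bump_sub_atom ν hc, setIntegral_eq_of_subset_of_forall_sdiff_eq_zero
    measurableSet_Ioi Ioc_subset_Ioi_self hzero]
  calc ∫ x in Ioc (0 : ℝ≥0) ((1 / 2) ^ n), bump (2 ^ n) x ∂ν
      ≤ ∫ x in Ioc (0 : ℝ≥0) ((1 / 2) ^ n), 1 ∂ν :=
        setIntegral_mono ((isC1b_bump hc).integrable ν).integrableOn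
          (integrable_const 1).integrableOn fun x => bump_le_one hc x.2
    _ = ν.real (Ioc 0 ((1 / 2) ^ n)) := by simp

theorem measure_le_integral_bump_sub_atom (ν : Measure ℝ≥0) [IsFiniteMeasure ν] (n : ℕ) :
    ν.real (Ioc 0 ((1 / 2) ^ (n + 1))) ≤ 4 * (∫ x : ℝ≥0, bump (2 ^ n) x ∂ν - ν.real {0}) := by
  have hc : (0 : ℝ) ≤ 2 ^ n := by positivity
  have hint := (isC1b_bump hc).integrable ν
  have hquarter : ∀ x ∈ Ioc (0 : ℝ≥0) ((1 / 2) ^ (n + 1)), 1 / 4 ≤ bump (2 ^ n) x := fun x hx => by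
    have hx_le : (x : ℝ) ≤ (1 / 2) ^ (n + 1) := by exact_mod_cast hx.2
    refine quarter_le_bump ?_
    calc 2 ^ n * (x : ℝ) ≤ 2 ^ n * (1 / 2) ^ (n + 1) := by gcongr
      _ = 1 / 2 := by
        rw [pow_succ, ← mul_assoc, two_pow_mul_half_pow, one_mul]
  have hlower := setIntegral_ge_of_const_le_real measurableSet_Ioc (measure_ne_top ν _) hquarter
    hint.integrableOn
  have hmono : ∫ x in Ioc (0 : ℝ≥0) ((1 / 2) ^ (n + 1)), bump (2 ^ n) x ∂ν ≤
      ∫ x in Ioi (0 : ℝ≥0), bump (2 ^ n) x ∂ν :=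
    setIntegral_mono_set hint.integrableOn (.of_forall fun x => bump_nonneg _ x)
      Ioc_subset_Ioi_self.eventuallyLE
  rw [integral_bump_sub_atom ν hc]
  linarith

theorem measure_le_sum_shell_add (ν : Measure ℝ≥0) [IsFiniteMeasure ν] {n m : ℕ} (hnm : n ≤ m) :
    ν.real (Ioc 0 ((1 / 2) ^ n)) ≤
      ∑ k ∈ Finset.Ico n m, ν.real (shell k) + ν.real (Ioc 0 ((1 / 2) ^ m)) := by
  induction m, hnm using Nat.le_induction with
  | base => simp
  | succ m hnm ih =>
    have hsplit : Ioc (0 : ℝ≥0) ((1 / 2) ^ m) = Ioc 0 ((1 / 2) ^ (m + 1)) ∪ shell m :=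
      (Ioc_union_Ioc_eq_Ioc zero_le
        (pow_le_pow_of_le_one zero_le (by norm_num) m.le_succ)).symm
    have hle := measureReal_union_le (μ := ν) (Ioc (0 : ℝ≥0) ((1 / 2) ^ (m + 1))) (shell m)
    rw [← hsplit] at hle
    rw [Finset.sum_Ico_succ_top hnm]
    linarith

theorem tendsto_integral_bump (ν : Measure ℝ≥0) [IsFiniteMeasure ν] :
    Tendsto (fun n : ℕ => ∫ x : ℝ≥0, bump (2 ^ n) x ∂ν) atTop (𝓝 (ν.real {0})) := by
  rw [← integral_indicator_one (measurableSet_singleton (0 : ℝ≥0))]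
  refine tendsto_integral_of_dominated_convergence (fun _ => 1)
    (fun n => ((isC1b_bump (by positivity)).integrable ν).aestronglyMeasurable)
    (integrable_const 1) (fun n => .of_forall fun x => ?_) (.of_forall fun x => ?_)
  · rw [Real.norm_of_nonneg (bump_nonneg _ _)]
    exact bump_le_one (by positivity) x.2
  · rcases eq_or_ne x 0 with rfl | hx
    · simp [bump_zero]
    · have hscale : Tendsto (fun n : ℕ => (2 : ℝ) ^ n * x) atTop atTop :=
        (tendsto_pow_atTop_atTop_of_one_lt one_lt_two).atTop_mul_const
          (NNReal.coe_pos.2 (pos_iff_ne_zero.2 hx))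
      rw [indicator_of_notMem (by simpa using hx)]
      refine tendsto_const_nhds.congr' ?_
      filter_upwards [hscale.eventually_ge_atTop 1] with n hn
      exact (bump_eq_zero hn).symm

theorem integral_bump_sub_atom_le_sum_shell (ν : Measure ℝ≥0) [IsFiniteMeasure ν] {n N : ℕ}
    (hnN : n ≤ N) :
    ∫ x : ℝ≥0, bump (2 ^ n) x ∂ν - ν.real {0} ≤ ∑ k ∈ Finset.Ico n (N + 1), ν.real (shell k) +
      4 * (∫ x : ℝ≥0, bump (2 ^ N) x ∂ν - ν.real {0}) :=
  (integral_bump_sub_atom_le_measure ν n).trans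
    ((measure_le_sum_shell_add ν (hnN.trans N.le_succ)).trans
      (add_le_add_right (measure_le_integral_bump_sub_atom ν N) _))

theorem measure_Ioi_pos_of_moment_pos {μ : FiniteMeasure ℝ≥0} (hμ : 0 < moment 1 μ) :
    0 < (μ : Measure ℝ≥0) (Ioi 0) := by
  rw [pos_iff_ne_zero]
  intro hzero
  refine hμ.ne' ?_
  rw [moment, lintegral_eq_zero_iff (by fun_prop)]
  filter_upwards [measure_eq_zero_iff_ae_notMem.1 hzero] with x hx
  obtain rfl : x = 0 := by simpa using hx
  simp

namespace IsWeakSolution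

variable {h : ℝ → FiniteMeasure ℝ≥0}

theorem absolutelyContinuous (hsol : IsWeakSolution h) {φ : ℝ → ℝ} (hφ : IsC1b φ) {s t : ℝ}
    (hs : 0 ≤ s) (hst : s ≤ t) :
    AbsolutelyContinuousOnInterval (fun τ => ∫ x : ℝ≥0, φ x ∂(h τ : Measure ℝ≥0)) s t := by
  refine ((hsol φ hφ).1 (t + 1) (by linarith)).mono ?_
  rw [uIcc_of_le hst, uIcc_of_le (by linarith)]
  exact Icc_subset_Icc hs (by linarith)

theorem hasDerivAt (hsol : IsWeakSolution h) {φ : ℝ → ℝ} (hφ : IsC1b φ) :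
    ∀ᵐ τ, 0 < τ → HasDerivAt (fun s => ∫ x : ℝ≥0, φ x ∂(h s : Measure ℝ≥0)) (Q3tilde φ (h τ)) τ :=
  (ae_restrict_iff' measurableSet_Ioi).1 (hsol φ hφ).2

theorem monotoneOn_integral_bump (hsol : IsWeakSolution h) {c : ℝ} (hc : 0 ≤ c) :
    MonotoneOn (fun τ => ∫ x : ℝ≥0, bump c x ∂(h τ : Measure ℝ≥0)) (Ici 0) := by
  intro s hs t _ hst
  refine monotoneOn_of_absolutelyContinuous (hsol.absolutelyContinuous (isC1b_bump hc) hs hst) ?_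
    (left_mem_Icc.2 hst) (right_mem_Icc.2 hst) hst
  filter_upwards [hsol.hasDerivAt (isC1b_bump hc)] with u hu hmem
  refine ⟨_, hu (lt_of_le_of_lt hs hmem.1), ?_⟩
  rw [Q3tilde]
  linarith [Q32_bump_nonneg c (h u), Q31tilde_bump_nonpos hc (h u)]

theorem monotoneOn_atomAtZero (hsol : IsWeakSolution h) : MonotoneOn (atomAtZero h) (Ici 0) :=
  fun _ hs _ ht hst =>
    le_of_tendsto_of_tendsto' (tendsto_integral_bump (h _)) (tendsto_integral_bump (h _))
      fun n => hsol.monotoneOn_integral_bump (by positivity : (0 : ℝ) ≤ 2 ^ n) hs ht hst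

-- The atom is the infimum of the continuous functions `∫ bump (2 ^ n) ∂h(τ)`, hence upper
-- semicontinuous; monotonicity gives the other half of right continuity.
theorem continuousWithinAt_atomAtZero (hsol : IsWeakSolution h) {τ : ℝ} (hτ : 0 ≤ τ) :
    ContinuousWithinAt (atomAtZero h) (Ici τ) τ := by
  refine tendsto_order.2 ⟨fun y hy => ?_, fun y hy => ?_⟩
  · filter_upwards [self_mem_nhdsWithin] with s hs
    exact hy.trans_le (hsol.monotoneOn_atomAtZero hτ (hτ.trans hs) hs)
  · obtain ⟨n, hn⟩ := ((tendsto_integral_bump (h τ)).eventually_lt_const hy).exists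
    have hc : (0 : ℝ) ≤ 2 ^ n := by positivity
    have hτ_lt : τ < τ + 1 := lt_add_one τ
    have hcont := (hsol.absolutelyContinuous (isC1b_bump hc) hτ hτ_lt.le).continuousOn
    rw [uIcc_of_le hτ_lt.le] at hcont
    have hright : ContinuousWithinAt (fun s => ∫ x : ℝ≥0, bump (2 ^ n) x ∂(h s : Measure ℝ≥0))
        (Ici τ) τ := (hcont τ (left_mem_Icc.2 hτ_lt.le)).mono_of_mem_nhdsWithin
      (Icc_mem_nhdsGE hτ_lt)
    filter_upwards [hright.eventually_lt_const hn] with s hs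
    exact (measure_zero_le_integral_bump (h s) hc).trans_lt hs

theorem ae_differentiableAt_atomAtZero (hsol : IsWeakSolution h) :
    ∀ᵐ τ ∂(volume.restrict (Ici (0 : ℝ))), DifferentiableAt ℝ (atomAtZero h) τ := by
  rw [← restrict_Ioi_eq_restrict_Ici, ae_restrict_iff' measurableSet_Ioi]
  filter_upwards [hsol.monotoneOn_atomAtZero.ae_differentiableWithinAt_of_mem] with τ hτ hpos
  exact (hτ (Ioi_subset_Ici_self hpos)).differentiableAt (Ici_mem_nhds hpos)

theorem exists_mass_le (hsol : IsWeakSolution h) {t : ℝ} (ht : 0 ≤ t) :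
    ∃ M, ∀ τ ∈ Icc 0 t, (h τ : Measure ℝ≥0).real univ ≤ M := by
  have hcont := (hsol.absolutelyContinuous isC1b_one le_rfl ht).continuousOn
  rw [uIcc_of_le ht] at hcont
  obtain ⟨M, hM⟩ := isCompact_Icc.bddAbove_image hcont
  exact ⟨M, fun τ hτ => by simpa using hM (mem_image_of_mem _ hτ)⟩

theorem exists_pos_le_integral_mulExpNeg (hsol : IsWeakSolution h)
    (h0 : 0 < (h 0 : Measure ℝ≥0) (Ioi 0)) {t : ℝ} (ht : 0 ≤ t) :
    ∃ δ > 0, ∀ τ ∈ Icc 0 t, δ ≤ ∫ x : ℝ≥0, mulExpNeg x ∂(h τ : Measure ℝ≥0) := by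
  obtain ⟨M, hM⟩ := hsol.exists_mass_le ht
  have hM0 : 0 ≤ M := measureReal_nonneg.trans (hM 0 (left_mem_Icc.2 ht))
  have hpos := integral_mulExpNeg_pos h0
  refine ⟨_, mul_pos (Real.exp_pos (-(6 * M) * t)) hpos, fun τ hτ => ?_⟩
  have hgronwall := exp_mul_le_of_absolutelyContinuous (K := 6 * M) hτ.1
    (hsol.absolutelyContinuous isC1b_mulExpNeg le_rfl hτ.1) (by
      filter_upwards [hsol.hasDerivAt isC1b_mulExpNeg] with u hu hmem
      refine ⟨_, hu hmem.1, le_trans ?_ (neg_le_Q3tilde_mulExpNeg (h u))⟩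
      rw [neg_mul, neg_le_neg_iff]
      gcongr
      · exact integral_nonneg fun x => mulExpNeg_nonneg x.2
      · exact hM u ⟨hmem.1.le, hmem.2.le.trans hτ.2⟩)
  refine le_trans ?_ hgronwall
  gcongr ?_ * _
  exact Real.exp_le_exp.2 (by nlinarith [hτ.2])

theorem dyadicCascade (hsol : IsWeakSolution h) {a b : ℝ} (ha : 0 ≤ a) (hab : a ≤ b)
    (hconst : ∀ t ∈ Icc a b, atomAtZero h t = atomAtZero h a) :
    DyadicCascade a b
      (fun n t => ∫ x : ℝ≥0, bump (2 ^ n) x ∂(h t : Measure ℝ≥0) - atomAtZero h a)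
      (fun k t => (h t : Measure ℝ≥0).real (shell k))
      (fun n t => Q3tilde (bump (2 ^ n)) (h t)) where
  nonneg n t ht := by
    rw [← hconst t ht]
    exact sub_nonneg.2 (measure_zero_le_integral_bump (h t) (by positivity))
  mass_nonneg k t := measureReal_nonneg
  antitone t _ n N hnN := by
    refine sub_le_sub_right (integral_mono ((isC1b_bump (by positivity)).integrable _)
      ((isC1b_bump (by positivity)).integrable _) fun x => ?_) _
    exact bump_antitone_scale x.2 (pow_le_pow_right₀ one_le_two hnN)
  tendsto_zero := by
    rw [← hconst b (right_mem_Icc.2 hab), ← sub_self (atomAtZero h b)]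
    exact (tendsto_integral_bump (h b)).sub_const _
  le_sum t ht n N hnN := by
    rw [← hconst t ht]
    exact integral_bump_sub_atom_le_sum_shell (h t) hnN
  absolutelyContinuous n := (hsol.absolutelyContinuous (isC1b_bump (by positivity)) ha hab).sub
    (LipschitzWith.const (atomAtZero h a)).lipschitzOnWith.absolutelyContinuousOnInterval
  hasDerivAt n := by
    filter_upwards [hsol.hasDerivAt (isC1b_bump (by positivity : (0 : ℝ) ≤ 2 ^ n))] with u hu hmem
    exact (hu (ha.trans_lt hmem.1)).sub_const _
  flux_le n u _ := by
    have hlinear := Q31tilde_bump_nonpos (by positivity : (0 : ℝ) ≤ 2 ^ n) (h u)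
    rw [Q3tilde]
    linarith [sum_sq_measure_shell_le_Q32 (h u) n]

theorem strictMonoOn_atomAtZero (hsol : IsWeakSolution h)
    (h0 : 0 < (h 0 : Measure ℝ≥0) (Ioi 0)) : StrictMonoOn (atomAtZero h) (Ici 0) := by
  intro a ha t ht hat
  have hmono := hsol.monotoneOn_atomAtZero
  refine (hmono ha ht hat.le).lt_of_ne fun heq => ?_
  have hconst : ∀ s ∈ Icc a t, atomAtZero h s = atomAtZero h a := fun s hs => by
    have hs0 : s ∈ Ici (0 : ℝ) := le_trans ha hs.1
    exact le_antisymm (heq ▸ hmono hs0 ht hs.2) (hmono ha hs0 hs.1)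
  obtain ⟨δ, hδ, hδ_le⟩ := hsol.exists_pos_le_integral_mulExpNeg h0 ht
  refine (hsol.dyadicCascade ha hat.le hconst).false_of_source hat (c := δ / 8) (by positivity)
    fun n u hu => ?_
  have hsource := mul_integral_mulExpNeg_le_neg_Q31tilde (h u)
    (one_le_pow₀ one_le_two : (1 : ℝ) ≤ 2 ^ n)
  calc δ / 8 * (1 / 2) ^ n = 1 / (8 * 2 ^ n) * δ := by rw [one_div_pow]; field_simp
    _ ≤ 1 / (8 * 2 ^ n) * ∫ x : ℝ≥0, mulExpNeg x ∂(h u : Measure ℝ≥0) := by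
        gcongr
        exact hδ_le u ⟨(lt_of_le_of_lt ha hu.1).le, hu.2.le⟩
    _ ≤ Q3tilde (bump (2 ^ n)) (h u) := by
        rw [Q3tilde]
        linarith [Q32_bump_nonneg (2 ^ n) (h u)]

end IsWeakSolution

end BoseCondensate

theorem theorem4p1_general {h : ℝ → FiniteMeasure ℝ≥0} (hsol : BoseCondensate.IsWeakSolution h)
    (h0 : 0 < (h 0 : Measure ℝ≥0) (Ioi 0)) :
    (∀ τ ∈ Ici (0 : ℝ), ContinuousWithinAt (BoseCondensate.atomAtZero h) (Ici τ) τ) ∧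
    (∀ᵐ τ ∂(volume.restrict (Ici (0 : ℝ))),
      DifferentiableAt ℝ (BoseCondensate.atomAtZero h) τ) ∧
    StrictMonoOn (BoseCondensate.atomAtZero h) (Ici (0 : ℝ)) :=
  ⟨fun _ hτ => hsol.continuousWithinAt_atomAtZero hτ, hsol.ae_differentiableAt_atomAtZero,
    hsol.strictMonoOn_atomAtZero h0⟩

theorem theorem4p1 (h : ℝ → FiniteMeasure ℝ≥0) (h₀ : FiniteMeasure ℝ≥0)
    (hcurve : BoseCondensate.IsNarrowCurve h)
    (hsol : BoseCondensate.IsWeakSolution h)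
    (hinit : h 0 = h₀)
    (hN : 0 < BoseCondensate.moment 0 h₀)
    (hE : 0 < BoseCondensate.moment 1 h₀) :
    (∀ τ ∈ Ici (0 : ℝ), ContinuousWithinAt (BoseCondensate.atomAtZero h) (Ici τ) τ) ∧
    (∀ᵐ τ ∂(volume.restrict (Ici (0 : ℝ))),
      DifferentiableAt ℝ (BoseCondensate.atomAtZero h) τ) ∧
    StrictMonoOn (BoseCondensate.atomAtZero h) (Ici (0 : ℝ)) :=
  theorem4p1_general hsol (hinit ▸ BoseCondensate.measure_Ioi_pos_of_moment_pos hE)
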